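/- **Setting.** All manifolds and Lie groups are finite-dimensional and smooth. Let $Q$ be a manifold with a mechanical Lagrangian $L=\tfrac12\kappa-U$ and a constraint subbundle $D\subset TQ$. Let $G$ be a Lie group acting freely and properly on $Q$ and preserving $\kappa$, $U$ and $D$. Let $W$ be a $G$-invariant subbundle with $TQ=D\oplus W$ and $W_q=\{\eta_Q(q):\eta\in\mathfrak g_W\}$ for a Lie subalgebra $\mathfrak g_W\subset\mathfrak g$. Let $G_W$ be the connected subgroup with Lie algebra $\mathfrak g_W$, and assume that $H=G/G_W$ is an **abelian** Lie group. Put $\bar Q=Q/G_W$, with quotient maps $\pi_W:Q\to\bar Q$ and $\pi:\bar Q\to\bar Q/H$. For a manifold $P$ let $\Theta_P$ be the canonical 1-form of $T^*P$ and $\Omega_P=-d\Theta_P$. *Compression.* Let $\mathcal M=\kappa^\flat(D)\subset T^*Q$, with bundle projection $\tau:T^*Q\to Q$, canonical momentum map $J$, $\langle J(m),\xi\rangle=m(\xi_Q)$, and Hamiltonian $\mathcal H$ of $L$. Let $\bar\kappa$ be the metric on $\bar Q$ with $\bar\kappa(T\pi_W u,T\pi_W v)=\kappa(u,v)$ for $u,v\in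 D$, and let $\rho_W:\mathcal M\to T^*\bar Q$, $\rho_W(\kappa(v,\cdot))=\bar\kappa(T\pi_W v,\cdot)$ for $v\in D$. Let $A_W:TQ\to\mathfrak g_W$ be determined by $v-(A_W v)_Q\in D$, and let $P_D$ be the projection to $D$ along $W$. The form $\langle J,K_W\rangle$ on $\mathcal M$ is $(u,v)\mapsto\langle J(m),dA_W(P_DT\tau u,P_DT\tau v)\rangle$ for $u,v\in T_m\mathcal M$. Let $\overline{\langle J,K_W\rangle}$ and $\bar{\mathcal H}$ be the 2-form and the function on $T^*\bar Q$ whose pullbacks by $\rho_W$ are $\langle J,K_W\rangle$ and $\mathcal H|_{\mathcal M}$, and let $\bar X_{nh}$ be the compressed vector field, $i_{\bar X_{nh}}(\Omega_{\bar Q}-\overline{\langle J,K_W\rangle})=d\bar{\mathcal H}$. *Reduction.* Let $\bar B$ be a 2-form on $T^*\bar Q$ with $i_{\bar X_{nh}}\bar B=0$ such that $\overline{\langle J,K_W\rangle}+\bar B=\rho_H^*\mathfrak B$ for a 2-form $\mathfrak B$ on $(T^*\bar Q)/H$, where $\rho_H:T^*\bar Q\to(T^*\bar Q)/H$ is the quotient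 map. Let $\bar J:T^*\bar Q\to\mathfrak h^*$ be the canonical momentum map and $\bar\mu\in\mathfrak h^*$. On the leaf $\bar J^{-1}(\bar\mu)/H\subset(T^*\bar Q)/H$ let $\Omega_{\bar\mu}$ and $\mathcal H_{\bar\mu}$ be the 2-form and the function whose pullbacks to $\bar J^{-1}(\bar\mu)$ are the restrictions of $\Omega_{\bar Q}$ and $\bar{\mathcal H}$, and let $\mathfrak B_{\bar\mu}$ be the restriction of $\mathfrak B$. Let $\bar{\mathcal A}:T\bar Q\to\mathfrak h$ be the mechanical connection of $\bar\kappa$ ($\bar{\mathcal A}(\xi_{\bar Q})=\xi$, and $\ker\bar{\mathcal A}$ is orthogonal to the orbits). Let $\beta_{\bar\mu}$ be the 2-form on $\bar Q/H$, also regarded as a 2-form on $T^*(\bar Q/H)$, with $\pi^*\beta_{\bar\mu}=\langle\bar\mu,d\bar{\mathcal A}\rangle$. Let $\Upsilon:T^*(\bar Q/H)\to\bar J^{-1}(\bar\mu)/H$ be the diffeomorphism that sends a covector $b$ at $\pi(q)$ to the $H$-orbit of $b\circ T_q\pi+\langle\bar\mu,\bar{\mathcal A}_q\rangle$, and use it to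 regard $\Omega_{\bar\mu}$, $\mathfrak B_{\bar\mu}$, $\mathcal H_{\bar\mu}$ as objects on $T^*(\bar Q/H)$. Let $X_{red}$ be the reduced vector field on $T^*(\bar Q/H)$, $$i_{X_{red}}(\Omega_{\bar\mu}-\mathfrak B_{\bar\mu})=d\mathcal H_{\bar\mu}.$$ **Proposition.** Let $f\in C^\infty(\bar Q/H)$ be nowhere zero, and let $\Psi_f:T^*(\bar Q/H)\to T^*(\bar Q/H)$, $\Psi_f(\alpha)=f\alpha$. Then the following are equivalent. 1. The reduced system is transformed by $\Psi_f$ and the time rescaling $\frac1fX_{red}$ into a Hamiltonian system for the canonical form: there is a smooth vector field $X_C$ on $T^*(\bar Q/H)$ with $$T\Psi_f\circ\left(\tfrac1f X_{red}\right)=X_C\circ\Psi_f,\qquad i_{X_C}\Omega_{\bar Q/H}=d\left(\mathcal H_{\bar\mu}\circ\Psi_{1/f}\right).$$ 2. $\displaystyle i_{X_{red}}\left(df\wedge\Theta_{\bar Q/H}-f\,(\beta_{\bar\mu}+\Upsilon^*\mathfrak B_{\bar\mu})\right)=0.$ -/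

import Mathlib

open scoped Manifold ContDiff Topology
open Bundle (TotalSpace ContMDiffRiemannianMetric)

noncomputable section

namespace NHReduction

/-! ### Differential forms, vector fields and cotangent bundles -/

section Forms

variable {E : Type*} [NormedAddCommGroup E] [NormedSpace ℝ E]
  {K : Type*} [TopologicalSpace K] (I : ModelWithCorners ℝ E K)
  (M : Type*) [TopologicalSpace M] [ChartedSpace K M]

/-- The cotangent bundle `T*M`, as the total space of the dual of the tangent bundle. -/
abbrev CotangentBundle : Type _ :=
  TotalSpace (E →L[ℝ] ℝ) (fun x : M => TangentSpace I x →L[ℝ] ℝ)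

/-- The model with corners of the cotangent bundle. -/
abbrev cotModel : ModelWithCorners ℝ (E × (E →L[ℝ] ℝ)) (ModelProd K (E →L[ℝ] ℝ)) :=
  I.prod 𝓘(ℝ, E →L[ℝ] ℝ)

/-- Real 1-forms (fields of covectors). -/
abbrev OneForm : Type _ := (x : M) → TangentSpace I x →L[ℝ] ℝ

/-- Vector fields. -/
abbrev VField : Type _ := (x : M) → TangentSpace I x

variable {M}

/-- Smoothness of a 1-form. -/
def IsSmoothOneForm [IsManifold I 1 M] (θ : OneForm I M) : Prop :=
  ContMDiff I (cotModel I) ∞ (fun x => (⟨x, θ x⟩ : CotangentBundle I M))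

/-- Smoothness of a vector field. -/
def IsSmoothVField [IsManifold I 1 M] (X : VField I M) : Prop :=
  ContMDiff I I.tangent ∞ (fun x => (⟨x, X x⟩ : TangentBundle I M))

variable (M) in
/-- Smooth 2-forms. -/
structure TwoForm [IsManifold I 1 M] where
  toFun : (x : M) → TangentSpace I x →L[ℝ] TangentSpace I x →L[ℝ] ℝ
  alt : ∀ x u, toFun x u u = 0
  smooth : ContMDiff I (I.prod 𝓘(ℝ, E →L[ℝ] E →L[ℝ] ℝ)) ∞
    (fun x => TotalSpace.mk' (E →L[ℝ] E →L[ℝ] ℝ)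
      (E := fun x : M => TangentSpace I x →L[ℝ] TangentSpace I x →L[ℝ] ℝ) x (toFun x))

instance [IsManifold I 1 M] : CoeFun (TwoForm I M)
    (fun _ => (x : M) → TangentSpace I x →L[ℝ] TangentSpace I x →L[ℝ] ℝ) := ⟨TwoForm.toFun⟩

/-- The local representative of a 1-form in the preferred chart at `x`: its pullback by the inverse
chart, a 1-form on the model space. -/
def localRep (θ : OneForm I M) (x : M) (y : E) : TangentSpace 𝓘(ℝ, E) y →L[ℝ] ℝ :=
  (θ ((extChartAt I x).symm y)).comp (mfderiv 𝓘(ℝ, E) I (extChartAt I x).symm y)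

/-- The exterior derivative `dθ` of a 1-form on a manifold without boundary, evaluated at a point
`x` on two tangent vectors: the exterior derivative of the representative of `θ` in the chart at
`x` (Mathlib identifies the tangent space at `x` with the model space by this chart).
With this normalization `dθ(X, Y) = X(θ(Y)) - Y(θ(X)) - θ([X, Y])`. -/
def extD (θ : OneForm I M) (x : M) (u v : TangentSpace I x) : ℝ :=
  extDeriv (fun y : E => ContinuousAlternatingMap.ofSubsingleton ℝ E ℝ (0 : Fin 1)
    (localRep I θ x y)) (extChartAt I x x) ![(u : E), (v : E)]

/-- `u` is tangent at `x` to the subset `A`: it is the velocity of a smooth curve in `A`. For an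
embedded submanifold `A` these are exactly the vectors of its tangent space. -/
def IsTangentTo (A : Set M) (x : M) (u : TangentSpace I x) : Prop :=
  ∃ (c : ℝ → M) (J : Set ℝ), IsOpen J ∧ (0 : ℝ) ∈ J ∧ ContMDiffOn 𝓘(ℝ, ℝ) I ∞ c J ∧
    (∀ t ∈ J, c t ∈ A) ∧
    tangentMap 𝓘(ℝ, ℝ) I c ⟨0, (1 : ℝ)⟩ = (⟨x, u⟩ : TangentBundle I M)

/-- A smooth distribution of constant rank, i.e. a smooth subbundle of the tangent bundle. -/
def IsSmoothDistribution [IsManifold I 1 M] (D : (x : M) → Submodule ℝ (TangentSpace I x)) : Prop :=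
  ∃ r : ℕ, ∀ x : M, ∃ (V : Set M) (X : Fin r → VField I M), IsOpen V ∧ x ∈ V ∧
    (∀ i, ContMDiffOn I I.tangent ∞ (fun y => (⟨y, X i y⟩ : TangentBundle I M)) V) ∧
    ∀ y ∈ V, LinearIndependent ℝ (fun i => X i y) ∧
      Submodule.span ℝ (Set.range fun i => X i y) = D y

variable [IsManifold I 1 M]

variable (M) in
/-- The derivative `T τ` of the bundle projection `τ : T*M → M`. -/
def tproj (a : CotangentBundle I M) :
    TangentSpace (cotModel I) a →L[ℝ] TangentSpace I a.proj :=
  mfderiv (cotModel I) I (TotalSpace.proj : CotangentBundle I M → M) a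

variable (M) in
/-- The canonical 1-form `Θ` on `T*M`. -/
def canonicalOneForm : OneForm (cotModel I) (CotangentBundle I M) :=
  fun a => a.2.comp (tproj I M a)

variable (M) in
/-- The canonical 2-form `Ω = -dΘ` on `T*M`. -/
def canonicalForm (a : CotangentBundle I M) (u v : TangentSpace (cotModel I) a) : ℝ :=
  - extD (cotModel I) (canonicalOneForm I M) a u v

/-- The fibre scaling `Ψ_f : T*M → T*M`, `α ↦ f α`. -/
def fiberScale (f : M → ℝ) (a : CotangentBundle I M) : CotangentBundle I M :=
  ⟨a.proj, f a.proj • a.2⟩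

/-- The 2-form `df ∧ Θ` on `T*M`, where `f` is a function on the base. -/
def dfWedgeTheta (f : M → ℝ) (a : CotangentBundle I M) (u v : TangentSpace (cotModel I) a) : ℝ :=
  mvfderiv (cotModel I) (fun b : CotangentBundle I M => f b.proj) a u * canonicalOneForm I M a v
    - mvfderiv (cotModel I) (fun b : CotangentBundle I M => f b.proj) a v
      * canonicalOneForm I M a u

end Forms

/-! ### Riemannian metrics and mechanical Hamiltonians -/

section Mechanics

variable {E : Type*} [NormedAddCommGroup E] [NormedSpace ℝ E]
  {M : Type*} [TopologicalSpace M] [ChartedSpace E M] [IsManifold 𝓘(ℝ, E) ∞ M]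

variable (E M) in
/-- Smooth Riemannian metrics on `M`. -/
abbrev Metric : Type _ :=
  ContMDiffRiemannianMetric (IB := 𝓘(ℝ, E)) (n := ∞) (F := E)
    (E := fun x : M => TangentSpace 𝓘(ℝ, E) x)

/-- The inverse of the Legendre transformation `v ↦ κ(v, ·)` on one tangent space. -/
def sharp (κ : Metric E M) (a : CotangentBundle 𝓘(ℝ, E) M) : TangentSpace 𝓘(ℝ, E) a.proj :=
  Function.invFun (fun v => κ.inner a.proj v) a.2

/-- The Hamiltonian of the Lagrangian `L = κ/2 - U`: at `α = κ(v, ·)` it is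
`⟨α, v⟩ - L(v)`. -/
def mechHamiltonian (κ : Metric E M) (U : M → ℝ) (a : CotangentBundle 𝓘(ℝ, E) M) : ℝ :=
  a.2 (sharp κ a) - (1 / 2 * κ.inner a.proj (sharp κ a) (sharp κ a) - U a.proj)

/-- The constraint momentum space `κ♭(D) ⊆ T*M`. -/
def constraintSpace (κ : Metric E M) (D : (x : M) → Submodule ℝ (TangentSpace 𝓘(ℝ, E) x)) :
    Set (CotangentBundle 𝓘(ℝ, E) M) :=
  {a | ∃ v ∈ D a.proj, a.2 = κ.inner a.proj v}

end Mechanics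

/-! ### Group actions -/

section Actions

variable {EG : Type*} [NormedAddCommGroup EG] [NormedSpace ℝ EG]
  (G : Type*) [TopologicalSpace G] [ChartedSpace EG G] [Group G]
  {E : Type*} [NormedAddCommGroup E] [NormedSpace ℝ E]
  {M : Type*} [TopologicalSpace M] [ChartedSpace E M] [MulAction G M]

/-- The infinitesimal generator `ξ ↦ ξ_M(x)`, i.e. the derivative at `1` of `g ↦ g • x`. -/
def generator (x : M) : GroupLieAlgebra 𝓘(ℝ, EG) G →L[ℝ] TangentSpace 𝓘(ℝ, E) x :=
  (mfderiv 𝓘(ℝ, EG) 𝓘(ℝ, E) (fun g : G => g • x) (1 : G) :)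

/-- The canonical momentum map `T*M → 𝔤*`, `⟨J(α), ξ⟩ = α(ξ_M)`. -/
def momentumMap (a : CotangentBundle 𝓘(ℝ, E) M) : GroupLieAlgebra 𝓘(ℝ, EG) G →L[ℝ] ℝ :=
  a.2.comp (generator G a.proj)

variable {G} in
/-- The cotangent lift of the action to `T*M`: the element `g` sends `α` at `x` to
`α ∘ (T_x g)⁻¹` at `g • x`. -/
def cotangentLift (g : G) (a : CotangentBundle 𝓘(ℝ, E) M) : CotangentBundle 𝓘(ℝ, E) M :=
  ⟨g • a.proj, a.2.comp (mfderiv 𝓘(ℝ, E) 𝓘(ℝ, E) (fun x : M => g • x) a.proj).inverse⟩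

/-- `π : P → S` exhibits the manifold `S` as the orbit manifold of an action on `P`: it is a smooth
surjective submersion whose fibres are the orbits. -/
structure IsOrbitProjection {Γ : Type*} {E₁ : Type*} [NormedAddCommGroup E₁] [NormedSpace ℝ E₁]
    {K₁ : Type*} [TopologicalSpace K₁] (I : ModelWithCorners ℝ E₁ K₁)
    {E₂ : Type*} [NormedAddCommGroup E₂] [NormedSpace ℝ E₂]
    {K₂ : Type*} [TopologicalSpace K₂] (I' : ModelWithCorners ℝ E₂ K₂)
    {P : Type*} [TopologicalSpace P] [ChartedSpace K₁ P]
    {S : Type*} [TopologicalSpace S] [ChartedSpace K₂ S]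
    (act : Γ → P → P) (π : P → S) : Prop where
  smooth : ContMDiff I I' ∞ π
  submersion : Manifold.IsSubmersion I I' ∞ π
  surjective : Function.Surjective π
  fibre : ∀ p p', π p = π p' ↔ ∃ g, act g p = p'

end Actions

/-! ### The nonholonomic system, its symmetry group and its compression -/

section Nonholonomic

variable (E : Type*) [NormedAddCommGroup E] [NormedSpace ℝ E]
  (Q : Type*) [TopologicalSpace Q] [ChartedSpace E Q] [IsManifold 𝓘(ℝ, E) ∞ Q]

/-- A mechanical Lagrangian `L = κ/2 - U` on `TQ` together with a constraint distribution `D`. -/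
structure NonholonomicSystem where
  /-- kinetic energy metric -/
  κ : Metric E Q
  /-- potential -/
  U : Q → ℝ
  U_smooth : ContMDiff 𝓘(ℝ, E) 𝓘(ℝ, ℝ) ∞ U
  /-- constraint distribution -/
  D : (q : Q) → Submodule ℝ (TangentSpace 𝓘(ℝ, E) q)
  D_smooth : IsSmoothDistribution 𝓘(ℝ, E) D

variable {E Q}
variable {EG : Type*} [NormedAddCommGroup EG] [NormedSpace ℝ EG]
  (G : Type*) [TopologicalSpace G] [ChartedSpace EG G] [Group G] [MulAction G Q]

/-- `G` acts freely and properly on `Q`, and its lifted action preserves the Lagrangian and the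
constraint distribution. -/
structure IsSymmetryGroup (sys : NonholonomicSystem E Q) : Prop where
  free : ∀ (g : G) (q : Q), g • q = q → g = 1
  proper : ProperSMul G Q
  metric_inv : ∀ (g : G) (q : Q) (u v : TangentSpace 𝓘(ℝ, E) q),
    sys.κ.inner (g • q) (mfderiv 𝓘(ℝ, E) 𝓘(ℝ, E) (fun x : Q => g • x) q u)
      (mfderiv 𝓘(ℝ, E) 𝓘(ℝ, E) (fun x : Q => g • x) q v) = sys.κ.inner q u v
  potential_inv : ∀ (g : G) (q : Q), sys.U (g • q) = sys.U q
  constraint_inv : ∀ (g : G) (q : Q), ∀ u ∈ sys.D q,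
    mfderiv 𝓘(ℝ, E) 𝓘(ℝ, E) (fun x : Q => g • x) q u ∈ sys.D (g • q)

/-- `W` is a `G`-invariant vertical complement of the constraints with the vertical-symmetry
condition, `𝔤W` being the corresponding Lie subalgebra of `𝔤`: `TQ = D ⊕ W` and
`W_q = {η_Q(q) : η ∈ 𝔤W}`. -/
structure IsVerticalComplement (sys : NonholonomicSystem E Q)
    (W : (q : Q) → Submodule ℝ (TangentSpace 𝓘(ℝ, E) q))
    (𝔤W : Submodule ℝ (GroupLieAlgebra 𝓘(ℝ, EG) G)) : Prop where
  smooth : IsSmoothDistribution 𝓘(ℝ, E) W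
  isCompl : ∀ q, IsCompl (sys.D q) (W q)
  invariant : ∀ (g : G) (q : Q), ∀ u ∈ W q,
    mfderiv 𝓘(ℝ, E) 𝓘(ℝ, E) (fun x : Q => g • x) q u ∈ W (g • q)
  subalgebra : ∀ ξ ∈ 𝔤W, ∀ η ∈ 𝔤W, ⁅ξ, η⁆ ∈ 𝔤W
  vertical : ∀ q (u : TangentSpace 𝓘(ℝ, E) q), u ∈ W q ↔ ∃ η ∈ 𝔤W, generator G q η = u

variable {G} in
/-- `ϱ : G → H` exhibits the Lie group `H` as the quotient `G / G_W`, where `G_W = ker ϱ` is the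
connected Lie subgroup with Lie algebra `𝔤W`. -/
structure IsLieQuotient {EH : Type*} [NormedAddCommGroup EH] [NormedSpace ℝ EH]
    {H : Type*} [TopologicalSpace H] [ChartedSpace EH H] [Group H] (ϱ : G →* H)
    (𝔤W : Submodule ℝ (GroupLieAlgebra 𝓘(ℝ, EG) G)) : Prop where
  smooth : ContMDiff 𝓘(ℝ, EG) 𝓘(ℝ, EH) ∞ ϱ
  submersion : Manifold.IsSubmersion 𝓘(ℝ, EG) 𝓘(ℝ, EH) ∞ ϱ
  surjective : Function.Surjective ϱ
  connected : IsConnected (ϱ.ker : Set G)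
  lieAlgebra : ∀ ξ : GroupLieAlgebra 𝓘(ℝ, EG) G,
    ξ ∈ 𝔤W ↔ mfderiv 𝓘(ℝ, EG) 𝓘(ℝ, EH) ϱ (1 : G) ξ = 0

variable {G}

/-- `A` is the `𝔤`-valued 1-form `A_W`: `A_W(v) = ξ ∈ 𝔤W` iff the `W`-component of `v` in
`TQ = D ⊕ W` is `ξ_Q`. -/
structure IsVerticalOneForm (D : (q : Q) → Submodule ℝ (TangentSpace 𝓘(ℝ, E) q))
    (𝔤W : Submodule ℝ (GroupLieAlgebra 𝓘(ℝ, EG) G))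
    (A : (q : Q) → TangentSpace 𝓘(ℝ, E) q →L[ℝ] GroupLieAlgebra 𝓘(ℝ, EG) G) : Prop where
  smooth : ∀ lam : GroupLieAlgebra 𝓘(ℝ, EG) G →L[ℝ] ℝ,
    IsSmoothOneForm 𝓘(ℝ, E) (fun q => lam.comp (A q))
  mem : ∀ q v, A q v ∈ 𝔤W
  horizontal : ∀ q v, v - generator G q (A q v) ∈ D q

/-- The 2-form `⟨J, K_W⟩`: for `m ∈ T*Q` and `u, v` tangent to `T*Q` at `m` it is the pairing of
`J(m)` with `K_W(Tτ u, Tτ v) = dA_W(P_D Tτ u, P_D Tτ v)`. Its restriction to the constraint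
momentum space is the form of the theory. -/
def formJK (A : (q : Q) → TangentSpace 𝓘(ℝ, E) q →L[ℝ] GroupLieAlgebra 𝓘(ℝ, EG) G)
    (m : CotangentBundle 𝓘(ℝ, E) Q) (u v : TangentSpace (cotModel 𝓘(ℝ, E)) m) : ℝ :=
  extD 𝓘(ℝ, E) (fun q => (momentumMap G m).comp (A q)) m.proj
    (tproj 𝓘(ℝ, E) Q m u - generator G m.proj (A m.proj (tproj 𝓘(ℝ, E) Q m u)))
    (tproj 𝓘(ℝ, E) Q m v - generator G m.proj (A m.proj (tproj 𝓘(ℝ, E) Q m v)))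

variable {E' : Type*} [NormedAddCommGroup E'] [NormedSpace ℝ E']
  {Qb : Type*} [TopologicalSpace Qb] [ChartedSpace E' Qb] [IsManifold 𝓘(ℝ, E') ∞ Qb]

/-- The compressed metric `κb` on `Qb = Q/G_W`, `κb(Tπ u, Tπ v) = κ(u, v)` for `u, v ∈ D`. -/
def IsCompressedMetric (sys : NonholonomicSystem E Q) (πW : Q → Qb) (κb : Metric E' Qb) : Prop :=
  ∀ q, ∀ u ∈ sys.D q, ∀ v ∈ sys.D q,
    κb.inner (πW q) (mfderiv 𝓘(ℝ, E) 𝓘(ℝ, E') πW q u) (mfderiv 𝓘(ℝ, E) 𝓘(ℝ, E') πW q v)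
      = sys.κ.inner q u v

/-- The projection `ρ_W : κ♭(D) → κ♭(D)/G_W ≅ T*Qb`, `κ(v, ·) ↦ κb(Tπ v, ·)` (the formula makes
sense on all of `T*Q`; only its restriction to `κ♭(D)` matters). -/
def compression (κ : Metric E Q) (πW : Q → Qb) (κb : Metric E' Qb)
    (m : CotangentBundle 𝓘(ℝ, E) Q) : CotangentBundle 𝓘(ℝ, E') Qb :=
  ⟨πW m.proj, κb.inner (πW m.proj) (mfderiv 𝓘(ℝ, E) 𝓘(ℝ, E') πW m.proj (sharp κ m))⟩

/-- The compressed Hamiltonian `h` on `T*Qb`: `ρ_W^* h` is the Hamiltonian on `κ♭(D)`. -/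
structure IsCompressedHamiltonian (sys : NonholonomicSystem E Q) (πW : Q → Qb) (κb : Metric E' Qb)
    (h : CotangentBundle 𝓘(ℝ, E') Qb → ℝ) : Prop where
  smooth : ContMDiff (cotModel 𝓘(ℝ, E')) 𝓘(ℝ, ℝ) ∞ h
  pullback : ∀ m ∈ constraintSpace sys.κ sys.D,
    h (compression sys.κ πW κb m) = mechHamiltonian sys.κ sys.U m

/-- The 2-form `jk` on `T*Qb` whose pullback by `ρ_W` is `⟨J, K_W⟩` on `κ♭(D)`. -/
def IsCompressedJK (sys : NonholonomicSystem E Q)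
    (A : (q : Q) → TangentSpace 𝓘(ℝ, E) q →L[ℝ] GroupLieAlgebra 𝓘(ℝ, EG) G)
    (πW : Q → Qb) (κb : Metric E' Qb)
    (jk : TwoForm (cotModel 𝓘(ℝ, E')) (CotangentBundle 𝓘(ℝ, E') Qb)) : Prop :=
  ∀ m ∈ constraintSpace sys.κ sys.D, ∀ u v : TangentSpace (cotModel 𝓘(ℝ, E)) m,
    IsTangentTo (cotModel 𝓘(ℝ, E)) (constraintSpace sys.κ sys.D) m u →
    IsTangentTo (cotModel 𝓘(ℝ, E)) (constraintSpace sys.κ sys.D) m v →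
    jk (compression sys.κ πW κb m)
      (mfderiv (cotModel 𝓘(ℝ, E)) (cotModel 𝓘(ℝ, E')) (compression sys.κ πW κb) m u)
      (mfderiv (cotModel 𝓘(ℝ, E)) (cotModel 𝓘(ℝ, E')) (compression sys.κ πW κb) m v)
      = formJK A m u v

/-- `X` satisfies the compressed Hamilton equations `i_X (Ω - jk) = dh` on `T*Qb`. -/
structure IsCompressedDynamics (jk : TwoForm (cotModel 𝓘(ℝ, E')) (CotangentBundle 𝓘(ℝ, E') Qb))
    (h : CotangentBundle 𝓘(ℝ, E') Qb → ℝ)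
    (X : VField (cotModel 𝓘(ℝ, E')) (CotangentBundle 𝓘(ℝ, E') Qb)) : Prop where
  smooth : IsSmoothVField (cotModel 𝓘(ℝ, E')) X
  hamilton : ∀ a w, canonicalForm 𝓘(ℝ, E') Qb a (X a) w - jk a (X a) w
    = mvfderiv (cotModel 𝓘(ℝ, E')) h a w

end Nonholonomic

/-! ### The second reduction, by the abelian group `H`, at a momentum value `μ` -/

section Leaf

variable {E : Type*} [NormedAddCommGroup E] [NormedSpace ℝ E]
  {Qb : Type*} [TopologicalSpace Qb] [ChartedSpace E Qb] [IsManifold 𝓘(ℝ, E) ∞ Qb]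
  {EH : Type*} [NormedAddCommGroup EH] [NormedSpace ℝ EH]
  {H : Type*} [TopologicalSpace H] [ChartedSpace EH H] [CommGroup H] [MulAction H Qb]
  {ES : Type*} [NormedAddCommGroup ES] [NormedSpace ℝ ES]
  {S : Type*} [TopologicalSpace S] [ChartedSpace ES S] [IsManifold 𝓘(ℝ, ES) ∞ S]
  {EN : Type*} [NormedAddCommGroup EN] [NormedSpace ℝ EN]
  {N : Type*} [TopologicalSpace N] [ChartedSpace EN N] [IsManifold 𝓘(ℝ, EN) ∞ N]

/-- The mechanical connection `A` of the metric `κb`: the `𝔥`-valued 1-form with `A(ξ_Qb) = ξ` whose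
kernel is orthogonal to the orbits. -/
structure IsMechanicalConnection (κb : Metric E Qb)
    (A : (q : Qb) → TangentSpace 𝓘(ℝ, E) q →L[ℝ] GroupLieAlgebra 𝓘(ℝ, EH) H) : Prop where
  smooth : ∀ lam : GroupLieAlgebra 𝓘(ℝ, EH) H →L[ℝ] ℝ,
    IsSmoothOneForm 𝓘(ℝ, E) (fun q => lam.comp (A q))
  vertical : ∀ q (ξ : GroupLieAlgebra 𝓘(ℝ, EH) H), A q (generator H q ξ) = ξ
  orthogonal : ∀ q v, A q v = 0 → ∀ ξ : GroupLieAlgebra 𝓘(ℝ, EH) H,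
    κb.inner q v (generator H q ξ) = 0

/-- The 2-form `β_μ` on `S = Qb/H` with `π^* β_μ = ⟨μ, dA⟩`. -/
def IsMagneticForm (A : (q : Qb) → TangentSpace 𝓘(ℝ, E) q →L[ℝ] GroupLieAlgebra 𝓘(ℝ, EH) H)
    (μ : GroupLieAlgebra 𝓘(ℝ, EH) H →L[ℝ] ℝ) (π : Qb → S) (β : TwoForm 𝓘(ℝ, ES) S) : Prop :=
  ∀ q (u v : TangentSpace 𝓘(ℝ, E) q),
    β (π q) (mfderiv 𝓘(ℝ, E) 𝓘(ℝ, ES) π q u) (mfderiv 𝓘(ℝ, E) 𝓘(ℝ, ES) π q v)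
      = extD 𝓘(ℝ, E) (fun q => μ.comp (A q)) q u v

/-- The 2-form `𝔅` on `N = (T*Qb)/H` with `ρ^* 𝔅 = jk + B`; its existence means that `jk + B` is
basic. -/
def IsReductionOfSum (jk B : TwoForm (cotModel 𝓘(ℝ, E)) (CotangentBundle 𝓘(ℝ, E) Qb))
    (ρ : CotangentBundle 𝓘(ℝ, E) Qb → N) (𝔅 : TwoForm 𝓘(ℝ, EN) N) : Prop :=
  ∀ a (u v : TangentSpace (cotModel 𝓘(ℝ, E)) a),
    𝔅 (ρ a) (mfderiv (cotModel 𝓘(ℝ, E)) 𝓘(ℝ, EN) ρ a u)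
      (mfderiv (cotModel 𝓘(ℝ, E)) 𝓘(ℝ, EN) ρ a v) = jk a u v + B a u v

/-- The level set `J⁻¹(μ) ⊆ T*Qb` of the canonical momentum map of the `H`-action. -/
def levelSet (μ : GroupLieAlgebra 𝓘(ℝ, EH) H →L[ℝ] ℝ) : Set (CotangentBundle 𝓘(ℝ, E) Qb) :=
  {a | momentumMap H a = μ}

/-- The shift identification `Υ : T*S → J⁻¹(μ)/H ⊆ (T*Qb)/H` defined by the connection `A`: a
covector `b` at `π q` is sent to the orbit of the covector `b ∘ Tπ + ⟨μ, A⟩` at `q`. -/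
def IsShift {T : Type*} (A : (q : Qb) → TangentSpace 𝓘(ℝ, E) q →L[ℝ] GroupLieAlgebra 𝓘(ℝ, EH) H)
    (μ : GroupLieAlgebra 𝓘(ℝ, EH) H →L[ℝ] ℝ) (π : Qb → S)
    (ρ : CotangentBundle 𝓘(ℝ, E) Qb → T) (Υ : CotangentBundle 𝓘(ℝ, ES) S → T) : Prop :=
  ∀ (q : Qb) (b : TangentSpace 𝓘(ℝ, ES) (π q) →L[ℝ] ℝ),
    Υ ⟨π q, b⟩ = ρ ⟨q, b.comp (mfderiv 𝓘(ℝ, E) 𝓘(ℝ, ES) π q) + μ.comp (A q)⟩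

/-- The Marsden-Weinstein reduced form `Ω_μ` of the canonical form of `T*Qb`, transported to `T*S`
by `Υ`: the pullback of the form on `J⁻¹(μ)/H` to `J⁻¹(μ)` is the restriction of the canonical
form. -/
def IsReducedCanonicalForm (μ : GroupLieAlgebra 𝓘(ℝ, EH) H →L[ℝ] ℝ)
    (ρ : CotangentBundle 𝓘(ℝ, E) Qb → N) (Υ : CotangentBundle 𝓘(ℝ, ES) S → N)
    (Ωμ : TwoForm (cotModel 𝓘(ℝ, ES)) (CotangentBundle 𝓘(ℝ, ES) S)) : Prop :=
  ∀ a ∈ levelSet μ, ∀ u₁ u₂ : TangentSpace (cotModel 𝓘(ℝ, E)) a,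
    IsTangentTo (cotModel 𝓘(ℝ, E)) (levelSet μ) a u₁ →
    IsTangentTo (cotModel 𝓘(ℝ, E)) (levelSet μ) a u₂ →
    ∀ (b : CotangentBundle 𝓘(ℝ, ES) S) (w₁ w₂ : TangentSpace (cotModel 𝓘(ℝ, ES)) b),
      tangentMap (cotModel 𝓘(ℝ, ES)) 𝓘(ℝ, EN) Υ ⟨b, w₁⟩
        = tangentMap (cotModel 𝓘(ℝ, E)) 𝓘(ℝ, EN) ρ ⟨a, u₁⟩ →
      tangentMap (cotModel 𝓘(ℝ, ES)) 𝓘(ℝ, EN) Υ ⟨b, w₂⟩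
        = tangentMap (cotModel 𝓘(ℝ, E)) 𝓘(ℝ, EN) ρ ⟨a, u₂⟩ →
      Ωμ b w₁ w₂ = canonicalForm 𝓘(ℝ, E) Qb a u₁ u₂

/-- The reduced Hamiltonian, transported to `T*S` by `Υ`: the function on `J⁻¹(μ)/H` whose pullback
to `J⁻¹(μ)` is the restriction of `h`. -/
structure IsReducedHamiltonian {T : Type*} (μ : GroupLieAlgebra 𝓘(ℝ, EH) H →L[ℝ] ℝ)
    (ρ : CotangentBundle 𝓘(ℝ, E) Qb → T) (Υ : CotangentBundle 𝓘(ℝ, ES) S → T)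
    (h : CotangentBundle 𝓘(ℝ, E) Qb → ℝ) (hμ : CotangentBundle 𝓘(ℝ, ES) S → ℝ) : Prop where
  smooth : ContMDiff (cotModel 𝓘(ℝ, ES)) 𝓘(ℝ, ℝ) ∞ hμ
  pullback : ∀ a ∈ levelSet μ, ∀ b, Υ b = ρ a → hμ b = h a

/-- The pullback `Υ^* 𝔅`. -/
def pullbackForm (Υ : CotangentBundle 𝓘(ℝ, ES) S → N) (𝔅 : TwoForm 𝓘(ℝ, EN) N)
    (b : CotangentBundle 𝓘(ℝ, ES) S) (u v : TangentSpace (cotModel 𝓘(ℝ, ES)) b) : ℝ :=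
  𝔅 (Υ b) (mfderiv (cotModel 𝓘(ℝ, ES)) 𝓘(ℝ, EN) Υ b u)
    (mfderiv (cotModel 𝓘(ℝ, ES)) 𝓘(ℝ, EN) Υ b v)

/-- `X` is the reduced vector field on the leaf: `i_X (Ω_μ - 𝔅_μ) = d hμ`, written on `T*S`. -/
structure IsReducedDynamics (Ωμ : TwoForm (cotModel 𝓘(ℝ, ES)) (CotangentBundle 𝓘(ℝ, ES) S))
    (Υ : CotangentBundle 𝓘(ℝ, ES) S → N) (𝔅 : TwoForm 𝓘(ℝ, EN) N)
    (hμ : CotangentBundle 𝓘(ℝ, ES) S → ℝ)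
    (X : VField (cotModel 𝓘(ℝ, ES)) (CotangentBundle 𝓘(ℝ, ES) S)) : Prop where
  smooth : IsSmoothVField (cotModel 𝓘(ℝ, ES)) X
  hamilton : ∀ b w, Ωμ b (X b) w - pullbackForm Υ 𝔅 b (X b) w
    = mvfderiv (cotModel 𝓘(ℝ, ES)) hμ b w

end Leaf

end NHReduction

end

/-! Everything reduces to two pullback formulas for canonical forms. The first is
`canonicalForm_fiberScale`. Since `Ψ_f^*Θ = fΘ`, the Leibniz rule for `d` gives `Ψ_f^*Ω = fΩ - df ∧
Θ`. The second is `reducedCanonicalForm_eq`: carried to `T*S` by `Υ`, the reduced form is `Ω_μ = Ω -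
β`. To see it, lift `Υ` locally to `T*Qb` along a section `σ` of `π`, as `b ↦ b ∘ Tπ + ⟨μ, A⟩` at
`σ(τ b)`. The lift takes values in `J⁻¹(μ)` and pulls `Θ` back to `Θ + (σ ∘ τ)^*⟨μ, A⟩`. As `⟨μ, dA⟩
= π^*β` and `π ∘ σ = id`, the extra term has differential `τ^*β`.

Now `Ψ_f` is a diffeomorphism with inverse `Ψ_{1/f}`, so the only candidate for `X_C` is the
push-forward of `(1/f) X_red`, which is smooth. Pulling its Hamilton equation back by `Ψ_f` gives
`i_{X_red}(Ω - (1/f) df ∧ Θ) = dh_μ`. The reduced equation reads `i_{X_red}(Ω - β - Υ^*𝔅) = dh_μ`.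
Subtracting the two and multiplying by `f` leaves exactly the second condition, and every step is
reversible pointwise. -/

noncomputable section

namespace NHReduction

/-! ### Smooth maps into the cotangent bundle -/

section CotangentSmoothness

variable {E : Type*} [NormedAddCommGroup E] [NormedSpace ℝ E]
  {K : Type*} [TopologicalSpace K] {I : ModelWithCorners ℝ E K}
  {M : Type*} [TopologicalSpace M] [ChartedSpace K M] [IsManifold I ∞ M]
  {E' : Type*} [NormedAddCommGroup E'] [NormedSpace ℝ E']
  {K' : Type*} [TopologicalSpace K'] {I' : ModelWithCorners ℝ E' K'}
  {M' : Type*} [TopologicalSpace M'] [ChartedSpace K' M'] [IsManifold I' ∞ M']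
  {EP : Type*} [NormedAddCommGroup EP] [NormedSpace ℝ EP]
  {KP : Type*} [TopologicalSpace KP] {J : ModelWithCorners ℝ EP KP}
  {P : Type*} [TopologicalSpace P] [ChartedSpace KP P]

/-- The coordinates of a covector at `x`, in the trivialization of the tangent bundle at `x₀`. -/
def covectorCoord (I : ModelWithCorners ℝ E K) [IsManifold I ∞ M] (x₀ x : M) (b : E →L[ℝ] ℝ) :
    E →L[ℝ] ℝ :=
  b.comp ((trivializationAt E (TangentSpace I : M → Type _) x₀).symmL ℝ x : E →L[ℝ] E)

/-- A map into the cotangent bundle is smooth iff its base map and its covector coordinates are. -/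
theorem contMDiffAt_cotangent_iff {F : P → CotangentBundle I M} {p₀ : P} {n : ℕ∞ω} :
    ContMDiffAt J (cotModel I) n F p₀ ↔ ContMDiffAt J I n (fun p => (F p).proj) p₀ ∧
      ContMDiffAt J 𝓘(ℝ, E →L[ℝ] ℝ) n
        (fun p => covectorCoord I (F p₀).proj (F p).proj (F p).2) p₀ := by
  rw [contMDiffAt_hom_bundle]
  refine and_congr_right fun _ => ?_
  have : (fun p => ContinuousLinearMap.inCoordinates E (TangentSpace I) ℝ (fun _ : M => ℝ)
      (F p₀).proj (F p).proj (F p₀).proj (F p).proj (F p).2) =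
      fun p => covectorCoord I (F p₀).proj (F p).proj (F p).2 := by
    funext p
    ext v
    simp [ContinuousLinearMap.inCoordinates, covectorCoord]
    rfl
  rw [this]

theorem contMDiffAt_cotangent_proj {a : CotangentBundle I M} {n : ℕ∞ω} :
    ContMDiffAt (cotModel I) I n (TotalSpace.proj : CotangentBundle I M → M) a :=
  Bundle.contMDiffAt_proj _

theorem ContMDiffAt.cotangent_smul {F : P → CotangentBundle I M} {c : P → ℝ} {p₀ : P} {n : ℕ∞ω}
    (hF : ContMDiffAt J (cotModel I) n F p₀) (hc : ContMDiffAt J 𝓘(ℝ, ℝ) n c p₀) :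
    ContMDiffAt J (cotModel I) n
      (fun p => (⟨(F p).proj, c p • (F p).2⟩ : CotangentBundle I M)) p₀ := by
  rw [contMDiffAt_cotangent_iff] at hF ⊢
  exact ⟨hF.1, hc.smul hF.2⟩

theorem ContMDiffAt.cotangent_add {g : P → M} {b₁ b₂ : P → E →L[ℝ] ℝ} {p₀ : P} {n : ℕ∞ω}
    (h₁ : ContMDiffAt J (cotModel I) n (fun p => (⟨g p, b₁ p⟩ : CotangentBundle I M)) p₀)
    (h₂ : ContMDiffAt J (cotModel I) n (fun p => (⟨g p, b₂ p⟩ : CotangentBundle I M)) p₀) :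
    ContMDiffAt J (cotModel I) n
      (fun p => (⟨g p, b₁ p + b₂ p⟩ : CotangentBundle I M)) p₀ := by
  rw [contMDiffAt_cotangent_iff] at h₁ h₂ ⊢
  refine ⟨h₁.1, ?_⟩
  exact h₁.2.add h₂.2

/-- Smoothness of the transpose of a derivative applied to a smooth family of covectors. -/
theorem ContMDiffAt.cotangent_comp_mfderiv [IsManifold J 1 P]
    {g : P → M} {φ : M → M'} {c : P → E' →L[ℝ] ℝ} {p₀ : P}
    (hg : ContMDiffAt J I ∞ g p₀) (hφ : ContMDiffAt I I' ∞ φ (g p₀))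
    (hc : ContMDiffAt J (cotModel I') ∞ (fun p => (⟨φ (g p), c p⟩ : CotangentBundle I' M')) p₀) :
    ContMDiffAt J (cotModel I) ∞
      (fun p => (⟨g p, (c p).comp (mfderiv I I' φ (g p) : E →L[ℝ] E')⟩ :
        CotangentBundle I M)) p₀ := by
  rw [contMDiffAt_cotangent_iff] at hc ⊢
  refine ⟨hg, ?_⟩
  -- In trivializations the transpose is composition with the matrix of `Tφ`, which depends smoothly
  -- on the point; `φ` enters as a constant family.
  have hd : ContMDiffAt J 𝓘(ℝ, E →L[ℝ] E') ∞
      (inTangentCoordinates I I' g (fun p => φ (g p)) (fun p => mfderiv I I' φ (g p)) p₀) p₀ := by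
    refine ContMDiffAt.mfderiv (n := ∞) (fun _ => φ) g ?_ hg le_rfl
    exact ContMDiffAt.comp (p₀, g p₀) hφ contMDiffAt_snd
  refine (hc.2.clm_comp hd).congr_of_eventuallyEq ?_
  -- The trivialization at `φ (g p₀)` and its inverse cancel only over its base set, hence only for
  -- `p` near `p₀`.
  have hnear : ∀ᶠ p in 𝓝 p₀, φ (g p) ∈
      (trivializationAt E' (TangentSpace I' : M' → Type _) (φ (g p₀))).baseSet := by
    refine (ContinuousAt.comp hφ.continuousAt hg.continuousAt).eventually_mem ?_
    exact (trivializationAt E' (TangentSpace I' : M' → Type _) _).open_baseSet.mem_nhds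
      (FiberBundle.mem_baseSet_trivializationAt' _)
  filter_upwards [hnear] with p hp
  ext v
  simp only [covectorCoord, inTangentCoordinates, ContinuousLinearMap.inCoordinates,
    ContinuousLinearMap.comp_apply]
  exact congrArg (c p) ((trivializationAt E' (TangentSpace I' : M' → Type _)
    (φ (g p₀))).symmL_continuousLinearMapAt (R := ℝ) hp _).symm

end CotangentSmoothness

/-! ### Calculus of the exterior derivative of 1-forms -/

section ExteriorDerivative

variable {E : Type*} [NormedAddCommGroup E] [NormedSpace ℝ E]
  {K : Type*} [TopologicalSpace K] {I : ModelWithCorners ℝ E K}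
  {M : Type*} [TopologicalSpace M] [ChartedSpace K M]
  {E' : Type*} [NormedAddCommGroup E'] [NormedSpace ℝ E']
  {K' : Type*} [TopologicalSpace K'] {I' : ModelWithCorners ℝ E' K'}
  {M' : Type*} [TopologicalSpace M'] [ChartedSpace K' M']

theorem extD_congr {θ θ' : OneForm I M} {x : M} (h : ∀ᶠ y in 𝓝 x, θ y = θ' y)
    (u v : TangentSpace I x) :
    extD I θ x u v = extD I θ' x u v := by
  unfold extD
  have hs : Filter.Tendsto (extChartAt I x).symm (𝓝 (extChartAt I x x)) (𝓝 x) := by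
    simpa [ContinuousAt] using continuousAt_extChartAt_symm (I := I) x
  rw [Filter.EventuallyEq.extDeriv_eq]
  filter_upwards [hs.eventually h] with y hy
  simp only [localRep, hy]

/-- `localRep`, with values in the dual of the model space. -/
def modelLocalRep (I : ModelWithCorners ℝ E K) (θ : OneForm I M) (x : M) (y : E) : E →L[ℝ] ℝ :=
  localRep I θ x y

variable [IsManifold I ∞ M] [IsManifold I' ∞ M']

/-- Smoothness of a 1-form at a point. -/
def SmoothOneFormAt (I : ModelWithCorners ℝ E K) [IsManifold I ∞ M]
    (θ : OneForm I M) (x : M) : Prop :=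
  ContMDiffAt I (cotModel I) ∞ (fun y => (⟨y, θ y⟩ : CotangentBundle I M)) x

variable [I.Boundaryless] [I'.Boundaryless]

theorem SmoothOneFormAt.differentiableAt_localRep {θ : OneForm I M} {x : M}
    (h : SmoothOneFormAt I θ x) : DifferentiableAt ℝ (modelLocalRep I θ x) (extChartAt I x x) := by
  have h2 := (contMDiffAt_cotangent_iff.1 h).2
  have hs : ContMDiffAt 𝓘(ℝ, E) I ∞ (extChartAt I x).symm (extChartAt I x x) :=
    (contMDiffOn_extChartAt_symm (n := ∞) x).contMDiffAt (extChartAt_target_mem_nhds x)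
  have h3 : ContMDiffAt I 𝓘(ℝ, E →L[ℝ] ℝ) ∞ (fun p => covectorCoord I x p (θ p))
      ((extChartAt I x).symm (extChartAt I x x)) := by
    rw [extChartAt_to_inv]
    exact h2
  have h4 := (ContMDiffAt.comp _ h3 hs).contDiffAt.differentiableAt (by simp)
  refine h4.congr_of_eventuallyEq ?_
  filter_upwards [extChartAt_target_mem_nhds (I := I) x] with y hy
  have hsrc : (extChartAt I x).symm y ∈ (chartAt K x).source := by
    have := (extChartAt I x).map_target hy
    rwa [extChartAt_source] at this
  have := TangentBundle.symmL_trivializationAt (𝕜 := ℝ) (I := I) hsrc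
  rw [I.range_eq_univ, mfderivWithin_univ, (extChartAt I x).right_inv hy] at this
  simp only [modelLocalRep, localRep, Function.comp, covectorCoord]
  exact congrArg (ContinuousLinearMap.comp (M₁ := E) (M₂ := E) (θ ((extChartAt I x).symm y)))
    this.symm

/-- The antisymmetrized derivative in coordinates, to which the product and sum rules for `fderiv`
apply directly. -/
theorem extD_apply {θ : OneForm I M} {x : M} (h : SmoothOneFormAt I θ x) (u v : E) :
    extD I θ x u v = fderiv ℝ (modelLocalRep I θ x) (extChartAt I x x) u v -
      fderiv ℝ (modelLocalRep I θ x) (extChartAt I x x) v u := by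
  have hd := h.differentiableAt_localRep
  have h1 : DifferentiableAt ℝ (fun y : E => ContinuousAlternatingMap.ofSubsingleton ℝ E ℝ
      (0 : Fin 1) (modelLocalRep I θ x y)) (extChartAt I x x) :=
    (ContinuousAlternatingMap.ofSubsingletonLIE (𝕜 := ℝ) (E := E) (F := ℝ)
      (0 : Fin 1)).differentiable.differentiableAt.comp
      _ hd
  have h2 := extDeriv_apply h1 ![u, v]
  have h3 : ∀ w : E, fderiv ℝ (fun y => modelLocalRep I θ x y w) (extChartAt I x x) =
      (fderiv ℝ (modelLocalRep I θ x) (extChartAt I x x)).flip w := by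
    intro w
    rw [fderiv_clm_apply hd (differentiableAt_const w)]
    simp
  refine h2.trans ?_
  generalize extChartAt I x x = z at h3
  simp [Fin.sum_univ_two, Fin.removeNth, h3]
  ring

theorem extD_add {θ θ' : OneForm I M} {x : M} (h : SmoothOneFormAt I θ x)
    (h' : SmoothOneFormAt I θ' x) (u v : E) :
    extD I (fun y => θ y + θ' y) x u v = extD I θ x u v + extD I θ' x u v := by
  have hs : SmoothOneFormAt I (fun y => θ y + θ' y) x := ContMDiffAt.cotangent_add h h'
  have : modelLocalRep I (fun y => θ y + θ' y) x = modelLocalRep I θ x + modelLocalRep I θ' x := by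
    funext y
    ext w
    rfl
  rw [extD_apply hs, extD_apply h, extD_apply h', this,
    fderiv_add h.differentiableAt_localRep h'.differentiableAt_localRep]
  simp
  ring

/-- The inverse of the preferred chart at `x` has derivative the identity. -/
theorem mfderiv_extChartAt_symm_self (x : M) :
    (mfderiv 𝓘(ℝ, E) I (extChartAt I x).symm (extChartAt I x x) : E →L[ℝ] E) =
      ContinuousLinearMap.id ℝ E := by
  have hs : ContMDiffAt 𝓘(ℝ, E) I ∞ (extChartAt I x).symm (extChartAt I x x) :=
    (contMDiffOn_extChartAt_symm (n := ∞) x).contMDiffAt (extChartAt_target_mem_nhds x)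
  have hw : writtenInExtChartAt 𝓘(ℝ, E) I (extChartAt I x x) (extChartAt I x).symm
      =ᶠ[𝓝 (extChartAt I x x)] id := by
    -- The chart of the model space is the identity, so in charts the map is the preferred chart
    -- composed with its own inverse.
    filter_upwards [extChartAt_target_mem_nhds (I := I) x] with y hy
    simp only [writtenInExtChartAt, Function.comp, extChartAt_to_inv]
    exact (extChartAt I x).right_inv hy
  rw [(hs.mdifferentiableAt (by simp)).mfderiv]
  simp only [modelWithCornersSelf_coe, Set.range_id, fderivWithin_univ]
  exact hw.fderiv_eq.trans fderiv_id

/-- The Leibniz rule `d(cθ) = c dθ + dc ∧ θ`. With `c = f ∘ τ` and `θ = Θ` it produces the term `df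
∧ Θ`. -/
theorem extD_smul {θ : OneForm I M} {c : M → ℝ} {x : M} (h : SmoothOneFormAt I θ x)
    (hc : ContMDiffAt I 𝓘(ℝ, ℝ) ∞ c x) (u v : E) :
    extD I (fun y => c y • θ y) x u v =
      c x * extD I θ x u v + (mvfderiv I c x u * θ x v - mvfderiv I c x v * θ x u) := by
  have hs : SmoothOneFormAt I (fun y => c y • θ y) x := ContMDiffAt.cotangent_smul h hc
  have : modelLocalRep I (fun y => c y • θ y) x =
      fun y => (c ∘ (extChartAt I x).symm) y • modelLocalRep I θ x y := by
    funext y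
    ext w
    rfl
  have hcd : DifferentiableAt ℝ (c ∘ (extChartAt I x).symm) (extChartAt I x x) := by
    have h1 : ContMDiffAt 𝓘(ℝ, E) I ∞ (extChartAt I x).symm (extChartAt I x x) :=
      (contMDiffOn_extChartAt_symm (n := ∞) x).contMDiffAt (extChartAt_target_mem_nhds x)
    have h2 : ContMDiffAt I 𝓘(ℝ, ℝ) ∞ c ((extChartAt I x).symm (extChartAt I x x)) := by
      rwa [extChartAt_to_inv]
    exact (h2.comp _ h1).contDiffAt.differentiableAt (by simp)
  have hm : ∀ w : E, mvfderiv I c x w =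
      fderiv ℝ (c ∘ (extChartAt I x).symm) (extChartAt I x x) w := by
    intro w
    have := hc.mdifferentiableAt (by simp)
    rw [mvfderiv, this.mfderiv]
    simp [writtenInExtChartAt, I.range_eq_univ]
    rfl
  have hl : ∀ w : E, modelLocalRep I θ x (extChartAt I x x) w = θ x w := by
    intro w
    simp only [modelLocalRep, localRep, mfderiv_extChartAt_symm_self]
    -- Regarding `θ` as a map into the fixed space `E →L[ℝ] ℝ` removes the dependence of the type on
    -- the base point, so the point can be rewritten.
    have e : ∀ (ϑ : M → E →L[ℝ] ℝ),
        ϑ ((extChartAt I x).symm (extChartAt I x x)) w = ϑ x w := by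
      intro ϑ
      rw [extChartAt_to_inv]
    exact e θ
  have hp : ∀ a b : E, fderiv ℝ (modelLocalRep I (fun y => c y • θ y) x) (extChartAt I x x) a b =
      c x * fderiv ℝ (modelLocalRep I θ x) (extChartAt I x x) a b + mvfderiv I c x a * θ x b := by
    intro a b
    rw [this, fderiv_fun_smul hcd h.differentiableAt_localRep, hm a, ← hl b]
    simp
  refine (extD_apply hs u v).trans ?_
  rw [extD_apply h u v, hp, hp]
  ring

/-- Brings a pullback on manifolds to one between model spaces, by the chain rule for `φ ∘ e⁻¹ =
e'⁻¹ ∘ (e' ∘ φ ∘ e⁻¹)`, where `e` and `e'` are the charts at `x` and `φ x`. -/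
theorem localRep_pullback {θ : OneForm I' M'} {φ : M → M'} {θ' : OneForm I M} {x : M}
    (hφ : ContMDiffAt I I' ∞ φ x)
    (hθ : ∀ᶠ y in 𝓝 x, θ' y = (θ (φ y)).comp (mfderiv I I' φ y)) :
    ∀ᶠ y in 𝓝 (extChartAt I x x), modelLocalRep I θ' x y =
      (modelLocalRep I' θ (φ x) (writtenInExtChartAt I I' x φ y)).comp
        (fderiv ℝ (writtenInExtChartAt I I' x φ) y) := by
  have hs : Filter.Tendsto (extChartAt I x).symm (𝓝 (extChartAt I x x)) (𝓝 x) := by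
    simpa [ContinuousAt] using continuousAt_extChartAt_symm (I := I) x
  -- Only finite-order smoothness at a point spreads to a neighbourhood; order one suffices for the
  -- chain rule.
  have h1 : ∀ᶠ p in 𝓝 x, ContMDiffAt I I' 1 φ p :=
    (contMDiffAt_iff_contMDiffAt_nhds (by simp)).1 (hφ.of_le (by simp))
  have h2 : ∀ᶠ p in 𝓝 x, φ p ∈ (extChartAt I' (φ x)).source :=
    hφ.continuousAt.eventually_mem (extChartAt_source_mem_nhds (I := I') (φ x))
  filter_upwards [extChartAt_target_mem_nhds (I := I) x, hs.eventually hθ, hs.eventually h1,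
    hs.eventually h2] with y hy hθy hφy hsrc
  have he : MDifferentiableAt 𝓘(ℝ, E) I (extChartAt I x).symm y :=
    ((contMDiffOn_extChartAt_symm (n := ∞) x).contMDiffAt
      ((isOpen_extChartAt_target x).mem_nhds hy)).mdifferentiableAt (by simp)
  have he' : MDifferentiableAt I' 𝓘(ℝ, E') (extChartAt I' (φ x)) (φ ((extChartAt I x).symm y)) :=
    mdifferentiableAt_extChartAt (by simpa using hsrc)
  have hφd := hφy.mdifferentiableAt (by simp)
  have hw : MDifferentiableAt 𝓘(ℝ, E) 𝓘(ℝ, E') (writtenInExtChartAt I I' x φ) y :=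
    he'.comp y (hφd.comp y he)
  have htgt : writtenInExtChartAt I I' x φ y ∈ (extChartAt I' (φ x)).target :=
    (extChartAt I' (φ x)).map_source hsrc
  have hes : MDifferentiableAt 𝓘(ℝ, E') I' (extChartAt I' (φ x)).symm
      (writtenInExtChartAt I I' x φ y) :=
    ((contMDiffOn_extChartAt_symm (n := ∞) (φ x)).contMDiffAt
      ((isOpen_extChartAt_target _).mem_nhds htgt)).mdifferentiableAt (by simp)
  have hcomp : (extChartAt I' (φ x)).symm ∘ writtenInExtChartAt I I' x φ =ᶠ[𝓝 y]
      φ ∘ (extChartAt I x).symm := by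
    have hcont : ContinuousAt (φ ∘ (extChartAt I x).symm) y :=
      hφd.continuousAt.comp he.continuousAt
    filter_upwards [hcont.eventually_mem ((isOpen_extChartAt_source (I := I') (φ x)).mem_nhds hsrc)]
      with z hz
    exact (extChartAt I' (φ x)).left_inv hz
  have hd := hcomp.mfderiv_eq (I := 𝓘(ℝ, E)) (I' := I')
  rw [mfderiv_comp y hes hw, mfderiv_comp y hφd he, mfderiv_eq_fderiv] at hd
  have hpt := hcomp.self_of_nhds
  have hϑ : ∀ ϑ : M' → E' →L[ℝ] ℝ, ϑ ((extChartAt I' (φ x)).symm (writtenInExtChartAt I I' x φ y)) =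
      ϑ (φ ((extChartAt I x).symm y)) := fun ϑ => congrArg ϑ hpt
  ext v
  have hdv : (mfderiv 𝓘(ℝ, E') I' (extChartAt I' (φ x)).symm (writtenInExtChartAt I I' x φ y) :
        E' →L[ℝ] E') (fderiv ℝ (writtenInExtChartAt I I' x φ) y v) =
      (mfderiv I I' φ ((extChartAt I x).symm y) : E →L[ℝ] E')
        ((mfderiv 𝓘(ℝ, E) I (extChartAt I x).symm y : E →L[ℝ] E) v) :=
    congrArg (fun T : E →L[ℝ] E' => T v) hd
  simp only [modelLocalRep, localRep, hθy]
  refine Eq.trans ?_ (congrArg₂ (fun (T : E' →L[ℝ] ℝ) w => T w) (hϑ θ) hdv).symm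
  rfl

/-- Naturality of `d`, inherited from the model space through `localRep_pullback`. Both pullback
formulas for the canonical form rest on it. -/
theorem extD_pullback {θ : OneForm I' M'} {φ : M → M'} {θ' : OneForm I M} {x : M}
    (hφ : ContMDiffAt I I' ∞ φ x) (hs : SmoothOneFormAt I' θ (φ x))
    (hθ : ∀ᶠ y in 𝓝 x, θ' y = (θ (φ y)).comp (mfderiv I I' φ y)) (u v : TangentSpace I x) :
    extD I θ' x u v = extD I' θ (φ x) (mfderiv I I' φ x u) (mfderiv I I' φ x v) := by
  have hc : ContDiffAt ℝ ∞ (writtenInExtChartAt I I' x φ) (extChartAt I x x) := by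
    have := (contMDiffAt_iff.1 hφ).2
    rwa [I.range_eq_univ, contDiffWithinAt_univ] at this
  have hx : writtenInExtChartAt I I' x φ (extChartAt I x x) = extChartAt I' (φ x) (φ x) := by
    simp [writtenInExtChartAt]
  have hd : DifferentiableAt ℝ (fun y : E' => ContinuousAlternatingMap.ofSubsingleton ℝ E' ℝ
      (0 : Fin 1) (modelLocalRep I' θ (φ x) y)) (writtenInExtChartAt I I' x φ (extChartAt I x x)) := by
    rw [hx]
    exact (ContinuousAlternatingMap.ofSubsingletonLIE (𝕜 := ℝ) (E := E') (F := ℝ)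
      (0 : Fin 1)).differentiable.differentiableAt.comp _ hs.differentiableAt_localRep
  have hm : ∀ w : E, mfderiv I I' φ x w =
      fderiv ℝ (writtenInExtChartAt I I' x φ) (extChartAt I x x) w := by
    intro w
    rw [(hφ.mdifferentiableAt (by simp)).mfderiv, I.range_eq_univ, fderivWithin_univ]
    rfl
  -- Second-order smoothness of the map is needed: the second derivatives of `φ` cancel by symmetry.
  have key := extDeriv_pullback hd hc
    (by simpa using WithTop.coe_le_coe.2 (le_top : (2 : ℕ∞) ≤ ⊤))
  have hev : (fun y : E => ContinuousAlternatingMap.ofSubsingleton ℝ E ℝ (0 : Fin 1)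
      (modelLocalRep I θ' x y)) =ᶠ[𝓝 (extChartAt I x x)]
      fun y => (ContinuousAlternatingMap.ofSubsingleton ℝ E' ℝ (0 : Fin 1)
        (modelLocalRep I' θ (φ x) (writtenInExtChartAt I I' x φ y))).compContinuousLinearMap
          (fderiv ℝ (writtenInExtChartAt I I' x φ) y) := by
    filter_upwards [localRep_pullback hφ hθ] with y hy
    rw [hy]
    ext w
    rfl
  have e1 := hev.extDeriv_eq.trans key
  rw [hx] at e1
  have e2 := congrArg (fun T => T ![(u : E), v]) e1
  refine e2.trans ?_
  rw [ContinuousAlternatingMap.compContinuousLinearMap_apply]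
  refine congrArg (extDeriv _ _) ?_
  funext i
  fin_cases i
  · exact (hm u).symm
  · exact (hm v).symm

end ExteriorDerivative

/-! ### Chain rule on vectors and local sections of submersions -/

section Derivatives

variable {E : Type*} [NormedAddCommGroup E] [NormedSpace ℝ E]
  {K : Type*} [TopologicalSpace K] {I : ModelWithCorners ℝ E K}
  {M : Type*} [TopologicalSpace M] [ChartedSpace K M]
  {E' : Type*} [NormedAddCommGroup E'] [NormedSpace ℝ E']
  {K' : Type*} [TopologicalSpace K'] {I' : ModelWithCorners ℝ E' K'}
  {M' : Type*} [TopologicalSpace M'] [ChartedSpace K' M']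

/-- The chain rule, evaluated on a vector of the model space. -/
theorem mfderiv_comp_apply_of_eq {E'' : Type*} [NormedAddCommGroup E''] [NormedSpace ℝ E'']
    {K'' : Type*} [TopologicalSpace K''] {I'' : ModelWithCorners ℝ E'' K''}
    {M'' : Type*} [TopologicalSpace M''] [ChartedSpace K'' M'']
    {g : M' → M''} {φ : M → M'} {x : M} {y : M'} (hg : MDifferentiableAt I' I'' g y)
    (hφ : MDifferentiableAt I I' φ x) (hy : φ x = y) (v : E) :
    (mfderiv I I'' (fun z => g (φ z)) x : E →L[ℝ] E'') v =
      (mfderiv I' I'' g y : E' →L[ℝ] E'') ((mfderiv I I' φ x : E →L[ℝ] E') v) := by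
  subst hy
  exact congrArg (fun T : E →L[ℝ] E'' => T v) (mfderiv_comp x hg hφ)

theorem tangentBundle_mk_eq {x y : M} (h : x = y) {v w : E} (hvw : v = w) :
    (⟨x, v⟩ : TangentBundle I M) = ⟨y, w⟩ := by
  subst h hvw
  rfl

/-- A submersion has smooth local sections through every point. -/
theorem exists_local_section [I.Boundaryless] {π : M → M'}
    (hπ : Manifold.IsSubmersion I I' ∞ π) (q : M) :
    ∃ (σ : M' → M) (V : Set M'), IsOpen V ∧ π q ∈ V ∧ ContMDiffOn I' I ∞ σ V ∧ σ (π q) = q ∧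
      ∀ x ∈ V, π (σ x) = x := by
  have h := hπ.isSubmersionAt q
  have hq := h.mem_domChart_source
  have hπq := h.mem_codChart_source
  have hw := h.writtenInCharts
  set ed := h.domChart.extend I with hed
  set ec := h.codChart.extend I' with hec
  have hqd : q ∈ ed.source := by rwa [hed, OpenPartialHomeomorph.extend_source]
  have hqc : π q ∈ ec.source := by rwa [hec, OpenPartialHomeomorph.extend_source]
  -- In adapted charts `π` is the projection to the first factor; the section keeps the
  -- complementary coordinate frozen at its value at `q`.
  let ℓ : M' → E := fun x => h.equiv.symm (ec x, (h.equiv (ed q)).2)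
  have hwq : ec (π q) = (h.equiv (ed q)).1 := by
    have := hw (ed.map_source hqd)
    simpa [ed.left_inv hqd] using this
  have hℓq : ℓ (π q) = ed q := by
    simp only [ℓ, hwq]
    exact h.equiv.symm_apply_apply _
  have hcs : ContMDiffOn I' 𝓘(ℝ, E') ∞ ec h.codChart.source :=
    OpenPartialHomeomorph.contMDiffOn_extend h.codChart_mem_maximalAtlas
  have hℓ : ContMDiffOn I' 𝓘(ℝ, E) ∞ ℓ h.codChart.source := by
    have h1 : ContMDiffOn I' 𝓘(ℝ, E' × h.complement) ∞
        (fun x => (ec x, (h.equiv (ed q)).2)) h.codChart.source :=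
      hcs.prodMk_space contMDiffOn_const
    exact h.equiv.symm.toContinuousLinearMap.contMDiff.comp_contMDiffOn h1
  have htgt : IsOpen ed.target := h.domChart.isOpen_extend_target
  have hds : ContMDiffOn 𝓘(ℝ, E) I ∞ ed.symm ed.target := by
    have := contMDiffOn_extend_symm h.domChart_mem_maximalAtlas
    rwa [← OpenPartialHomeomorph.extend_target'] at this
  refine ⟨fun x => ed.symm (ℓ x), h.codChart.source ∩ ℓ ⁻¹' ed.target,
    hℓ.continuousOn.isOpen_inter_preimage h.codChart.open_source htgt,
    ⟨hπq, ?_⟩, ?_, ?_, ?_⟩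
  · simpa [hℓq] using ed.map_source hqd
  · exact hds.comp (hℓ.mono Set.inter_subset_left) fun x hx => hx.2
  · simp only [hℓq, ed.left_inv hqd]
  · rintro x ⟨hx, hxt⟩
    have h1 : ec (π (ed.symm (ℓ x))) = ec x := by
      have := hw hxt
      simpa [ℓ] using this
    have h2 : π (ed.symm (ℓ x)) ∈ h.codChart.source := by
      have h3 : ed.symm (ℓ x) ∈ h.domChart.source := by
        have := ed.map_target hxt
        rwa [hed, OpenPartialHomeomorph.extend_source] at this
      exact h.source_subset_preimage_source h3
    -- Equal coordinates imply equal points only inside the chart domain, hence the check `h2`.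
    exact ec.injOn (by rwa [hec, OpenPartialHomeomorph.extend_source])
      (by rwa [hec, OpenPartialHomeomorph.extend_source]) h1

end Derivatives

/-! ### Tangent vectors to subsets as velocities of curves -/

section Tangency

variable {E : Type*} [NormedAddCommGroup E] [NormedSpace ℝ E]
  {K : Type*} [TopologicalSpace K] {I : ModelWithCorners ℝ E K} [I.Boundaryless]
  {M : Type*} [TopologicalSpace M] [ChartedSpace K M] [IsManifold I ∞ M]
  {E' : Type*} [NormedAddCommGroup E'] [NormedSpace ℝ E']
  {K' : Type*} [TopologicalSpace K'] {I' : ModelWithCorners ℝ E' K'}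
  {M' : Type*} [TopologicalSpace M'] [ChartedSpace K' M']

/-- The image of the derivative of a smooth map into `A` is tangent to `A`. -/
theorem isTangentTo_mfderiv {s : M → M'} {V : Set M} {A : Set M'} {p : M} (hV : IsOpen V)
    (hp : p ∈ V) (hs : ContMDiffOn I I' ∞ s V) (hA : ∀ y ∈ V, s y ∈ A) (u : TangentSpace I p) :
    IsTangentTo I' A (s p) (mfderiv I I' s p u) := by
  let w : E := u
  -- The curve is the image under `s` of a straight line in the chart at `p`; since the inverse
  -- chart has identity derivative there, its velocity is the image of `u`.
  let ℓ : ℝ → E := fun t => extChartAt I p p + t • w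
  have hℓ0 : ℓ 0 = extChartAt I p p := by simp [ℓ]
  have hℓ : ContDiff ℝ ∞ ℓ := contDiff_const.add (contDiff_id.smul contDiff_const)
  have hsymm := contMDiffOn_extChartAt_symm (I := I) (n := ∞) p
  have hO : IsOpen ((extChartAt I p).target ∩ (extChartAt I p).symm ⁻¹' V) :=
    hsymm.continuousOn.isOpen_inter_preimage (isOpen_extChartAt_target p) hV
  have h0 : ℓ 0 ∈ (extChartAt I p).target ∩ (extChartAt I p).symm ⁻¹' V := by
    rw [hℓ0]
    exact ⟨mem_extChartAt_target p, by simpa using hp⟩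
  have hc : ContMDiffOn 𝓘(ℝ, ℝ) I ∞ (fun t => (extChartAt I p).symm (ℓ t))
      (ℓ ⁻¹' ((extChartAt I p).target ∩ (extChartAt I p).symm ⁻¹' V)) :=
    hsymm.comp hℓ.contMDiff.contMDiffOn fun t ht => ht.1
  refine ⟨fun t => s ((extChartAt I p).symm (ℓ t)),
    ℓ ⁻¹' ((extChartAt I p).target ∩ (extChartAt I p).symm ⁻¹' V), hO.preimage hℓ.continuous,
    h0, hs.comp hc fun t ht => ht.2, fun t ht => hA _ ht.2, ?_⟩
  have hpt : (extChartAt I p).symm (ℓ 0) = p := by rw [hℓ0, extChartAt_to_inv]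
  refine tangentBundle_mk_eq (congrArg s hpt) ?_
  have hsd : MDifferentiableAt I I' s p :=
    (hs.contMDiffAt (hV.mem_nhds hp)).mdifferentiableAt (by simp)
  have hed : MDifferentiableAt 𝓘(ℝ, E) I (extChartAt I p).symm (extChartAt I p p) :=
    (hsymm.contMDiffAt (extChartAt_target_mem_nhds p)).mdifferentiableAt (by simp)
  have hℓd : MDifferentiableAt 𝓘(ℝ, ℝ) 𝓘(ℝ, E) ℓ 0 :=
    (hℓ.differentiable (by simp)).differentiableAt.mdifferentiableAt
  have hcd : MDifferentiableAt 𝓘(ℝ, ℝ) I ((extChartAt I p).symm ∘ ℓ) 0 :=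
    MDifferentiableAt.comp_of_eq (y := extChartAt I p p) (x := (0 : ℝ)) hed hℓd hℓ0
  have e3 : fderiv ℝ ℓ 0 (1 : ℝ) = w := by
    have : HasDerivAt ℓ ((1 : ℝ) • w) 0 :=
      ((hasDerivAt_id (0 : ℝ)).smul_const w).const_add (extChartAt I p p)
    simpa using this.deriv
  refine (mfderiv_comp_apply_of_eq (φ := (extChartAt I p).symm ∘ ℓ) hsd hcd hpt (1 : ℝ)).trans ?_
  refine congrArg (mfderiv I I' s p : E →L[ℝ] E') ?_
  refine (mfderiv_comp_apply_of_eq (φ := ℓ) hed hℓd hℓ0 (1 : ℝ)).trans ?_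
  rw [mfderiv_extChartAt_symm_self, mfderiv_eq_fderiv]
  exact e3

end Tangency

/-! ### Pullbacks of the canonical form and fibre scaling -/

section Canonical

variable {E : Type*} [NormedAddCommGroup E] [NormedSpace ℝ E]
  {K : Type*} [TopologicalSpace K] {I : ModelWithCorners ℝ E K}
  {M : Type*} [TopologicalSpace M] [ChartedSpace K M] [IsManifold I ∞ M]
  {EP : Type*} [NormedAddCommGroup EP] [NormedSpace ℝ EP]
  {KP : Type*} [TopologicalSpace KP] {J : ModelWithCorners ℝ EP KP}
  {P : Type*} [TopologicalSpace P] [ChartedSpace KP P] [IsManifold J ∞ P]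

theorem SmoothOneFormAt.pullback {θ : OneForm I M} {φ : P → M} {p : P}
    (hθ : SmoothOneFormAt I θ (φ p)) (hφ : ContMDiffAt J I ∞ φ p) :
    SmoothOneFormAt J (fun y => (θ (φ y)).comp (mfderiv J I φ y)) p :=
  haveI : IsManifold J 1 P := IsManifold.of_le (n := ∞) (by simp)
  ContMDiffAt.cotangent_comp_mfderiv (P := P) (M := P) (g := id) contMDiffAt_id hφ
    (hθ.comp p hφ)

/-- `Θ` is the transpose of `Tτ` applied to the tautological family of covectors, which as a map
into `T*M` is the identity. -/
theorem smoothOneFormAt_canonicalOneForm (a : CotangentBundle I M) :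
    SmoothOneFormAt (cotModel I) (canonicalOneForm I M) a :=
  ContMDiffAt.cotangent_comp_mfderiv (g := id) (c := fun p : CotangentBundle I M => p.2)
    contMDiffAt_id contMDiffAt_cotangent_proj contMDiffAt_id

theorem contMDiff_fiberScale {f : M → ℝ} (hf : ContMDiff I 𝓘(ℝ, ℝ) ∞ f) :
    ContMDiff (cotModel I) (cotModel I) ∞ (fiberScale I f) := fun a =>
  ContMDiffAt.cotangent_smul (F := id) contMDiffAt_id
    ((hf a.proj).comp a contMDiffAt_cotangent_proj)

variable [I.Boundaryless]

/-- The tautological property of the canonical form. -/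
theorem canonicalForm_mfderiv [J.Boundaryless] {s : P → CotangentBundle I M} {p : P}
    (hs : ContMDiffAt J (cotModel I) ∞ s p) (u v : TangentSpace J p) :
    canonicalForm I M (s p) (mfderiv J (cotModel I) s p u) (mfderiv J (cotModel I) s p v) =
      - extD J (fun y => (s y).2.comp (mfderiv J I (fun z => (s z).proj) y)) p u v := by
  have h1 : ∀ᶠ y in 𝓝 p, ContMDiffAt J (cotModel I) 1 s y :=
    (contMDiffAt_iff_contMDiffAt_nhds (by simp)).1 (hs.of_le (by simp))
  unfold canonicalForm
  rw [extD_pullback hs (smoothOneFormAt_canonicalOneForm (s p))]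
  filter_upwards [h1] with y hy
  have := mfderiv_comp y ((contMDiffAt_cotangent_proj (n := 1) (a := s y)).mdifferentiableAt
    (by simp))
    (hy.mdifferentiableAt (by simp))
  -- At `y` the pullback `s^*Θ` is the covector `s y` composed with `Tτ ∘ Ts = T(τ ∘ s)`.
  exact congrArg (ContinuousLinearMap.comp (s y).2) this

/-- `Ψ_f^* Ω = f Ω - df ∧ Θ`. -/
theorem canonicalForm_fiberScale {f : M → ℝ} (hf : ContMDiff I 𝓘(ℝ, ℝ) ∞ f)
    (a : CotangentBundle I M)
    (u v : TangentSpace (cotModel I) a) :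
    canonicalForm I M (fiberScale I f a)
      (mfderiv (cotModel I) (cotModel I) (fiberScale I f) a u)
      (mfderiv (cotModel I) (cotModel I) (fiberScale I f) a v) =
      f a.proj * canonicalForm I M a u v - dfWedgeTheta I f a u v := by
  rw [canonicalForm_mfderiv (contMDiff_fiberScale hf a)]
  have := extD_smul (smoothOneFormAt_canonicalOneForm a)
    (ContMDiffAt.comp a (hf a.proj) contMDiffAt_cotangent_proj) u v
  unfold canonicalForm dfWedgeTheta
  refine (congrArg Neg.neg this).trans ?_
  simp only [Function.comp_def]
  ring

end Canonical

/-! ### The momentum shift and the reduced canonical form -/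

section Shift

variable {EB : Type*} [NormedAddCommGroup EB] [NormedSpace ℝ EB]
  {Qb : Type*} [TopologicalSpace Qb] [ChartedSpace EB Qb]
  {EH : Type*} [NormedAddCommGroup EH] [NormedSpace ℝ EH]
  {H : Type*} [TopologicalSpace H] [ChartedSpace EH H] [CommGroup H]
  {ES : Type*} [NormedAddCommGroup ES] [NormedSpace ℝ ES]
  {S : Type*} [TopologicalSpace S] [ChartedSpace ES S]
  {EN : Type*} [NormedAddCommGroup EN] [NormedSpace ℝ EN]
  {N : Type*} [TopologicalSpace N] [ChartedSpace EN N]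

/-- The orbit projection annihilates the infinitesimal generators. -/
theorem mfderiv_generator_eq_zero [MulAction H Qb]
    [ContMDiffSMul 𝓘(ℝ, EH) 𝓘(ℝ, EB) ∞ H Qb] {π : Qb → S}
    (hπ : IsOrbitProjection 𝓘(ℝ, EB) 𝓘(ℝ, ES) (fun (g : H) (q : Qb) => g • q) π) (q : Qb)
    (ξ : GroupLieAlgebra 𝓘(ℝ, EH) H) :
    mfderiv 𝓘(ℝ, EB) 𝓘(ℝ, ES) π q (generator H q ξ) = 0 := by
  have hact : ContMDiff 𝓘(ℝ, EH) 𝓘(ℝ, EB) ∞ (fun g : H => g • q) :=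
    (ContMDiffSMul.contMDiff_smul (I := 𝓘(ℝ, EH)) (I' := 𝓘(ℝ, EB)) (n := ∞)).comp
      (contMDiff_id.prodMk contMDiff_const)
  have h := mfderiv_comp_apply_of_eq (x := (1 : H))
    ((hπ.smooth q).mdifferentiableAt (by simp))
    ((hact 1).mdifferentiableAt (by simp)) (one_smul H q) ξ
  -- `π` is constant along each orbit, so the derivative of `g ↦ π (g • q)` vanishes.
  have hconst : (fun g : H => π (g • q)) = fun _ => π q := by
    funext g
    exact ((hπ.fibre q (g • q)).2 ⟨g, rfl⟩).symm
  rw [hconst, mfderiv_const] at h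
  exact h.symm

/-- The lift to `T*Qb`, along a local section `σ` of `π`, of the shift by `⟨μ, A⟩`. -/
def shiftLift (A : (q : Qb) → TangentSpace 𝓘(ℝ, EB) q →L[ℝ] GroupLieAlgebra 𝓘(ℝ, EH) H)
    (μ : GroupLieAlgebra 𝓘(ℝ, EH) H →L[ℝ] ℝ) (π : Qb → S) (σ : S → Qb)
    (b : CotangentBundle 𝓘(ℝ, ES) S) : CotangentBundle 𝓘(ℝ, EB) Qb :=
  ⟨σ b.proj, (show ES →L[ℝ] ℝ from b.2).comp
    (mfderiv 𝓘(ℝ, EB) 𝓘(ℝ, ES) π (σ b.proj) : EB →L[ℝ] ES) + μ.comp (A (σ b.proj))⟩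

variable {A : (q : Qb) → TangentSpace 𝓘(ℝ, EB) q →L[ℝ] GroupLieAlgebra 𝓘(ℝ, EH) H}
  {μ : GroupLieAlgebra 𝓘(ℝ, EH) H →L[ℝ] ℝ} {π : Qb → S} {σ : S → Qb} {V : Set S}

theorem shift_eq_shiftLift {T : Type*} {ρ : CotangentBundle 𝓘(ℝ, EB) Qb → T}
    {Υ : CotangentBundle 𝓘(ℝ, ES) S → T} (hΥ : IsShift A μ π ρ Υ)
    {b : CotangentBundle 𝓘(ℝ, ES) S} (hb : π (σ b.proj) = b.proj) :
    Υ b = ρ (shiftLift A μ π σ b) := by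
  have h : (⟨π (σ b.proj), b.2⟩ : CotangentBundle 𝓘(ℝ, ES) S) = b :=
    TotalSpace.ext hb HEq.rfl
  exact (congrArg Υ h).symm.trans (hΥ (σ b.proj) b.2)

/-- On a generator `ξ_Qb` the summand `b ∘ Tπ` vanishes, because generators are vertical, and `⟨μ,
A⟩` gives `μ ξ`. -/
theorem shiftLift_mem_levelSet [MulAction H Qb]
    [ContMDiffSMul 𝓘(ℝ, EH) 𝓘(ℝ, EB) ∞ H Qb]
    (hπ : IsOrbitProjection 𝓘(ℝ, EB) 𝓘(ℝ, ES) (fun (g : H) (q : Qb) => g • q) π)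
    (hA : ∀ q (ξ : GroupLieAlgebra 𝓘(ℝ, EH) H), A q (generator H q ξ) = ξ)
    (b : CotangentBundle 𝓘(ℝ, ES) S) : shiftLift A μ π σ b ∈ levelSet μ := by
  have h : ∀ ξ, momentumMap H (shiftLift A μ π σ b) ξ = μ ξ := by
    intro ξ
    have h1 := mfderiv_generator_eq_zero hπ (σ b.proj) ξ
    have h2 : momentumMap H (shiftLift A μ π σ b) ξ =
      (show ES →L[ℝ] ℝ from b.2) (mfderiv 𝓘(ℝ, EB) 𝓘(ℝ, ES) π (σ b.proj)
        (generator H (σ b.proj) ξ)) + μ (A (σ b.proj) (generator H (σ b.proj) ξ)) := rfl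
    rw [h2, h1, hA]
    refine (congrArg (· + μ ξ) (map_zero (show ES →L[ℝ] ℝ from b.2))).trans (zero_add _)
  exact ContinuousLinearMap.ext h

variable [IsManifold 𝓘(ℝ, EB) ∞ Qb] [IsManifold 𝓘(ℝ, ES) ∞ S]

theorem contMDiffOn_shiftLift (hA : IsSmoothOneForm 𝓘(ℝ, EB) (fun q => μ.comp (A q)))
    (hπ : ContMDiff 𝓘(ℝ, EB) 𝓘(ℝ, ES) ∞ π) (hV : IsOpen V)
    (hσ : ContMDiffOn 𝓘(ℝ, ES) 𝓘(ℝ, EB) ∞ σ V) (hπσ : ∀ x ∈ V, π (σ x) = x) :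
    ContMDiffOn (cotModel 𝓘(ℝ, ES)) (cotModel 𝓘(ℝ, EB)) ∞ (shiftLift (ES := ES) A μ π σ)
      {b | b.proj ∈ V} := by
  intro b hb
  refine ContMDiffAt.contMDiffWithinAt ?_
  have hσb : ContMDiffAt (cotModel 𝓘(ℝ, ES)) 𝓘(ℝ, EB) ∞
      (fun b : CotangentBundle 𝓘(ℝ, ES) S => σ b.proj) b :=
    ContMDiffAt.comp b (hσ.contMDiffAt (hV.mem_nhds hb)) contMDiffAt_cotangent_proj
  refine ContMDiffAt.cotangent_add ?_ ?_
  · refine ContMDiffAt.cotangent_comp_mfderiv (φ := π)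
      (c := fun b : CotangentBundle 𝓘(ℝ, ES) S => b.2) hσb (hπ _) ?_
    -- Over `V` the covector `b`, placed at `π (σ (τ b))`, is `b` itself, so the family is locally
    -- the identity of `T*S`.
    refine contMDiffAt_id.congr_of_eventuallyEq ?_
    filter_upwards [(contMDiffAt_cotangent_proj (I := 𝓘(ℝ, ES)) (n := 0)
      (a := b)).continuousAt.eventually_mem (hV.mem_nhds hb)] with y hy
    exact TotalSpace.ext (hπσ _ hy) HEq.rfl
  · exact (hA (σ b.proj)).comp b hσb

/-- The pullback of the canonical form of `T*Qb` by the shift is `Ω - β`. -/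
theorem canonicalForm_shiftLift (hA : IsSmoothOneForm 𝓘(ℝ, EB) (fun q => μ.comp (A q)))
    (hπ : ContMDiff 𝓘(ℝ, EB) 𝓘(ℝ, ES) ∞ π) (hV : IsOpen V)
    (hσ : ContMDiffOn 𝓘(ℝ, ES) 𝓘(ℝ, EB) ∞ σ V) (hπσ : ∀ x ∈ V, π (σ x) = x)
    {β : TwoForm 𝓘(ℝ, ES) S} (hβ : IsMagneticForm A μ π β)
    {b : CotangentBundle 𝓘(ℝ, ES) S} (hb : b.proj ∈ V)
    (u v : TangentSpace (cotModel 𝓘(ℝ, ES)) b) :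
    canonicalForm 𝓘(ℝ, EB) Qb (shiftLift A μ π σ b)
      (mfderiv (cotModel 𝓘(ℝ, ES)) (cotModel 𝓘(ℝ, EB)) (shiftLift A μ π σ) b u)
      (mfderiv (cotModel 𝓘(ℝ, ES)) (cotModel 𝓘(ℝ, EB)) (shiftLift A μ π σ) b v) =
    canonicalForm 𝓘(ℝ, ES) S b u v -
      β b.proj (tproj 𝓘(ℝ, ES) S b u) (tproj 𝓘(ℝ, ES) S b v) := by
  have hVb : ∀ᶠ y : CotangentBundle 𝓘(ℝ, ES) S in 𝓝 b, y.proj ∈ V :=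
    (contMDiffAt_cotangent_proj (I := 𝓘(ℝ, ES)) (n := 0)
      (a := b)).continuousAt.eventually_mem (hV.mem_nhds hb)
  have hσp : ∀ y : CotangentBundle 𝓘(ℝ, ES) S, y.proj ∈ V →
      ContMDiffAt (cotModel 𝓘(ℝ, ES)) 𝓘(ℝ, EB) ∞
        (fun b : CotangentBundle 𝓘(ℝ, ES) S => σ b.proj) y := fun y hy =>
    ContMDiffAt.comp y (hσ.contMDiffAt (hV.mem_nhds hy)) contMDiffAt_cotangent_proj
  have hs : ContMDiffAt (cotModel 𝓘(ℝ, ES)) (cotModel 𝓘(ℝ, EB)) ∞ (shiftLift A μ π σ) b :=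
    (contMDiffOn_shiftLift hA hπ hV hσ hπσ).contMDiffAt hVb
  -- `Tπ ∘ T(σ ∘ τ) = Tτ`
  have hcomp : ∀ y : CotangentBundle 𝓘(ℝ, ES) S, y.proj ∈ V → ∀ w : ES × (ES →L[ℝ] ℝ),
      (mfderiv 𝓘(ℝ, EB) 𝓘(ℝ, ES) π (σ y.proj) : EB →L[ℝ] ES)
        ((mfderiv (cotModel 𝓘(ℝ, ES)) 𝓘(ℝ, EB)
          (fun b : CotangentBundle 𝓘(ℝ, ES) S => σ b.proj) y :
            ES × (ES →L[ℝ] ℝ) →L[ℝ] EB) w) =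
      (tproj 𝓘(ℝ, ES) S y : ES × (ES →L[ℝ] ℝ) →L[ℝ] ES) w := by
    intro y hy w
    have h1 := mfderiv_comp_apply_of_eq ((hπ (σ y.proj)).mdifferentiableAt (by simp))
      ((hσp y hy).mdifferentiableAt (by simp)) rfl w
    refine h1.symm.trans ?_
    have h2 : (fun z : CotangentBundle 𝓘(ℝ, ES) S => π (σ z.proj)) =ᶠ[𝓝 y]
        TotalSpace.proj := by
      filter_upwards [(contMDiffAt_cotangent_proj (I := 𝓘(ℝ, ES)) (n := 0)
        (a := y)).continuousAt.eventually_mem (hV.mem_nhds hy)] with z hz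
      exact hπσ _ hz
    exact congrArg (fun T : ES × (ES →L[ℝ] ℝ) →L[ℝ] ES => T w) h2.mfderiv_eq
  rw [canonicalForm_mfderiv hs]
  -- The excess over `Θ` in the pullback by the lift: `θ = (σ ∘ τ)^*⟨μ, A⟩`.
  let θ : OneForm (cotModel 𝓘(ℝ, ES)) (CotangentBundle 𝓘(ℝ, ES) S) := fun y =>
    (μ.comp (A (σ y.proj))).comp (mfderiv (cotModel 𝓘(ℝ, ES)) 𝓘(ℝ, EB)
      (fun b : CotangentBundle 𝓘(ℝ, ES) S => σ b.proj) y)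
  have hθ : SmoothOneFormAt (cotModel 𝓘(ℝ, ES)) θ b :=
    SmoothOneFormAt.pullback (θ := fun q => μ.comp (A q)) (hA (σ b.proj)) (hσp b hb)
  have e1 : extD (cotModel 𝓘(ℝ, ES)) (fun y : CotangentBundle 𝓘(ℝ, ES) S =>
      (shiftLift A μ π σ y).2.comp (mfderiv (cotModel 𝓘(ℝ, ES)) 𝓘(ℝ, EB)
        (fun z => (shiftLift A μ π σ z).proj) y)) b u v =
      extD (cotModel 𝓘(ℝ, ES)) (fun y => canonicalOneForm 𝓘(ℝ, ES) S y + θ y) b u v := by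
    refine extD_congr ?_ u v
    filter_upwards [hVb] with y hy
    refine ContinuousLinearMap.ext fun w => ?_
    exact congrArg (fun z : ES => (show ES →L[ℝ] ℝ from y.2) z + θ y w) (hcomp y hy w)
  -- `dθ = (σ ∘ τ)^*⟨μ, dA⟩ = (π ∘ σ ∘ τ)^*β = τ^*β`, the last equality holding over `V`.
  have e2 : extD (cotModel 𝓘(ℝ, ES)) θ b u v =
      β b.proj (tproj 𝓘(ℝ, ES) S b u) (tproj 𝓘(ℝ, ES) S b v) := by
    have h0 : extD (cotModel 𝓘(ℝ, ES)) θ b u v = _ :=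
      extD_pullback (hσp b hb) (hA (σ b.proj)) (Filter.Eventually.of_forall fun _ => rfl) u v
    refine h0.trans ?_
    refine (hβ (σ b.proj) _ _).symm.trans ?_
    have h3 : ∀ B : S → ES →L[ℝ] ES →L[ℝ] ℝ, B (π (σ b.proj)) = B b.proj :=
      fun B => congrArg B (hπσ _ hb)
    refine (congrArg (fun T : ES →L[ℝ] ES →L[ℝ] ℝ => T _ _) (h3 β)).trans ?_
    exact congrArg₂ (fun y z : ES => (show ES →L[ℝ] ES →L[ℝ] ℝ from β b.proj) y z)
      (hcomp b hb u) (hcomp b hb v)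
  rw [e1]
  refine (congrArg Neg.neg ((extD_add (smoothOneFormAt_canonicalOneForm b) hθ u v).trans
    (congrArg (_ + ·) e2))).trans ?_
  unfold canonicalForm
  ring

/-- The reduced canonical form, transported to `T*S` by the shift, is `Ω - β`. -/
theorem reducedCanonicalForm_eq [MulAction H Qb]
    [ContMDiffSMul 𝓘(ℝ, EH) 𝓘(ℝ, EB) ∞ H Qb]
    {κb : Metric EB Qb} (hA : IsMechanicalConnection κb A)
    (hπ : IsOrbitProjection 𝓘(ℝ, EB) 𝓘(ℝ, ES) (fun (g : H) (q : Qb) => g • q) π)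
    {β : TwoForm 𝓘(ℝ, ES) S} (hβ : IsMagneticForm A μ π β)
    {ρ : CotangentBundle 𝓘(ℝ, EB) Qb → N}
    (hρ : ContMDiff (cotModel 𝓘(ℝ, EB)) 𝓘(ℝ, EN) ∞ ρ)
    {Υ : CotangentBundle 𝓘(ℝ, ES) S → N} (hΥ : IsShift A μ π ρ Υ)
    {Ωμ : TwoForm (cotModel 𝓘(ℝ, ES)) (CotangentBundle 𝓘(ℝ, ES) S)}
    (hΩμ : IsReducedCanonicalForm (EN := EN) μ ρ Υ Ωμ) (b : CotangentBundle 𝓘(ℝ, ES) S)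
    (u v : TangentSpace (cotModel 𝓘(ℝ, ES)) b) :
    Ωμ b u v = canonicalForm 𝓘(ℝ, ES) S b u v -
      β b.proj (tproj 𝓘(ℝ, ES) S b u) (tproj 𝓘(ℝ, ES) S b v) := by
  obtain ⟨q, hq⟩ := hπ.surjective b.proj
  obtain ⟨σ, V, hV, hqV, hσ, -, hπσ⟩ := exists_local_section hπ.submersion q
  rw [hq] at hqV
  have hVo : IsOpen {b : CotangentBundle 𝓘(ℝ, ES) S | b.proj ∈ V} :=
    hV.preimage (FiberBundle.continuous_proj _ _)
  have hs := contMDiffOn_shiftLift (hA.smooth μ) hπ.smooth hV hσ hπσ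
  have hsb := hs.contMDiffAt (hVo.mem_nhds hqV)
  have hΥs : Υ =ᶠ[𝓝 b] fun y => ρ (shiftLift A μ π σ y) := by
    filter_upwards [hVo.mem_nhds hqV] with y hy
    exact shift_eq_shiftLift hΥ (hπσ _ hy)
  -- The defining property of `Ωμ` may be tested on images of vectors under the lift: they are
  -- tangent to the level set, and `ρ` sends them to the images under `TΥ`.
  have htan : ∀ w : TangentSpace (cotModel 𝓘(ℝ, ES)) b,
      IsTangentTo (cotModel 𝓘(ℝ, EB)) (levelSet μ) (shiftLift A μ π σ b)
        (mfderiv (cotModel 𝓘(ℝ, ES)) (cotModel 𝓘(ℝ, EB)) (shiftLift A μ π σ) b w) :=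
    isTangentTo_mfderiv hVo hqV hs fun y _ => shiftLift_mem_levelSet hπ hA.vertical y
  have hmap : ∀ w : TangentSpace (cotModel 𝓘(ℝ, ES)) b,
      tangentMap (cotModel 𝓘(ℝ, ES)) 𝓘(ℝ, EN) Υ ⟨b, w⟩ =
        tangentMap (cotModel 𝓘(ℝ, EB)) 𝓘(ℝ, EN) ρ ⟨shiftLift A μ π σ b,
          mfderiv (cotModel 𝓘(ℝ, ES)) (cotModel 𝓘(ℝ, EB)) (shiftLift A μ π σ) b w⟩ := by
    intro w
    refine tangentBundle_mk_eq hΥs.self_of_nhds ?_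
    refine (congrArg (fun T : ES × (ES →L[ℝ] ℝ) →L[ℝ] EN => T w) hΥs.mfderiv_eq).trans ?_
    exact mfderiv_comp_apply_of_eq ((hρ _).mdifferentiableAt (by simp))
      (hsb.mdifferentiableAt (by simp)) rfl w
  rw [hΩμ _ (shiftLift_mem_levelSet hπ hA.vertical b) _ _ (htan u) (htan v) b u v
    (hmap u) (hmap v)]
  exact canonicalForm_shiftLift (hA.smooth μ) hπ.smooth hV hσ hπσ hβ hqV u v

end Shift

/-! ### Fibre scaling as a diffeomorphism and push-forward of the rescaled field -/

section FiberScaling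

variable {E : Type*} [NormedAddCommGroup E] [NormedSpace ℝ E]
  {K : Type*} [TopologicalSpace K] {I : ModelWithCorners ℝ E K}
  {M : Type*} [TopologicalSpace M] [ChartedSpace K M] {f : M → ℝ}

theorem fiberScale_inv_fiberScale (hf0 : ∀ x, f x ≠ 0) (b : CotangentBundle I M) :
    fiberScale I (fun x => 1 / f x) (fiberScale I f b) = b := by
  have h : (1 / f b.proj) • (f b.proj • b.2) = b.2 := by
    rw [smul_smul, one_div_mul_cancel (hf0 _), one_smul]
  exact congrArg (fun y => (⟨b.proj, y⟩ : CotangentBundle I M)) h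

theorem fiberScale_fiberScale_inv (hf0 : ∀ x, f x ≠ 0) (b : CotangentBundle I M) :
    fiberScale I f (fiberScale I (fun x => 1 / f x) b) = b := by
  have h : f b.proj • ((1 / f b.proj) • b.2) = b.2 := by
    rw [smul_smul, mul_one_div_cancel (hf0 _), one_smul]
  exact congrArg (fun y => (⟨b.proj, y⟩ : CotangentBundle I M)) h

theorem contMDiff_one_div (hf : ContMDiff I 𝓘(ℝ, ℝ) ∞ f) (hf0 : ∀ x, f x ≠ 0) :
    ContMDiff I 𝓘(ℝ, ℝ) ∞ (fun x => 1 / f x) := by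
  simpa only [one_div] using hf.inv₀ hf0

variable [IsManifold I ∞ M]

/-- Differentiate `Ψ_f ∘ Ψ_{1/f} = id`. This allows Hamilton's equation to be tested on vectors
`TΨ_f w` alone. -/
theorem mfderiv_fiberScale_surjective (hf : ContMDiff I 𝓘(ℝ, ℝ) ∞ f) (hf0 : ∀ x, f x ≠ 0)
    (b : CotangentBundle I M) :
    Function.Surjective (mfderiv (cotModel I) (cotModel I) (fiberScale I f) b) := by
  intro w
  refine ⟨(mfderiv (cotModel I) (cotModel I) (fiberScale I (fun x => 1 / f x))
    (fiberScale I f b) : E × (E →L[ℝ] ℝ) →L[ℝ] E × (E →L[ℝ] ℝ)) w, ?_⟩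
  have h := mfderiv_comp_apply_of_eq
    (((contMDiff_fiberScale hf) b).mdifferentiableAt (by simp))
    (((contMDiff_fiberScale (contMDiff_one_div hf hf0)) (fiberScale I f b)).mdifferentiableAt
      (by simp)) (fiberScale_inv_fiberScale hf0 b) w
  have hid : (fun z => fiberScale I f (fiberScale I (fun x => 1 / f x) z)) = id :=
    funext (fiberScale_fiberScale_inv hf0)
  rw [hid, mfderiv_id] at h
  exact h.symm

/-- The derivative of `φ ∘ Ψ_{1/f}` at `Ψ_f b`, along the image of `w` under `TΨ_f`. -/
theorem mvfderiv_comp_fiberScale_inv {φ : CotangentBundle I M → ℝ}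
    (hφ : ContMDiff (cotModel I) 𝓘(ℝ, ℝ) ∞ φ) (hf : ContMDiff I 𝓘(ℝ, ℝ) ∞ f)
    (hf0 : ∀ x, f x ≠ 0) (b : CotangentBundle I M) (w : TangentSpace (cotModel I) b) :
    mvfderiv (cotModel I) (φ ∘ fiberScale I (fun x => 1 / f x)) (fiberScale I f b)
      (mfderiv (cotModel I) (cotModel I) (fiberScale I f) b w) =
      mvfderiv (cotModel I) φ b w := by
  have hφf : ContMDiff (cotModel I) 𝓘(ℝ, ℝ) ∞ (φ ∘ fiberScale I (fun x => 1 / f x)) :=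
    hφ.comp (contMDiff_fiberScale (contMDiff_one_div hf hf0))
  have h := mfderiv_comp_apply_of_eq (((hφf (fiberScale I f b))).mdifferentiableAt (by simp))
    (((contMDiff_fiberScale hf) b).mdifferentiableAt (by simp)) rfl w
  have hid : (fun z => (φ ∘ fiberScale I (fun x => 1 / f x)) (fiberScale I f z)) = φ :=
    funext fun z => congrArg φ (fiberScale_inv_fiberScale hf0 z)
  rw [hid] at h
  exact h.symm

/-- The push-forward of the rescaled vector field `(1/f) X` by `Ψ_f`. -/
def pushRescaled (f : M → ℝ) (X : VField (cotModel I) (CotangentBundle I M)) :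
    VField (cotModel I) (CotangentBundle I M) := fun c =>
  (mfderiv (cotModel I) (cotModel I) (fiberScale I f) (fiberScale I (fun x => 1 / f x) c) :
    E × (E →L[ℝ] ℝ) →L[ℝ] E × (E →L[ℝ] ℝ))
    ((1 / f c.proj) • X (fiberScale I (fun x => 1 / f x) c))

theorem pushRescaled_fiberScale (hf0 : ∀ x, f x ≠ 0)
    (X : VField (cotModel I) (CotangentBundle I M)) (b : CotangentBundle I M) :
    mfderiv (cotModel I) (cotModel I) (fiberScale I f) b ((1 / f b.proj) • X b) =
      pushRescaled f X (fiberScale I f b) :=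
  congrArg (fun a : CotangentBundle I M =>
    (mfderiv (cotModel I) (cotModel I) (fiberScale I f) a :
      E × (E →L[ℝ] ℝ) →L[ℝ] E × (E →L[ℝ] ℝ)) ((1 / f b.proj) • X a))
    (fiberScale_inv_fiberScale hf0 b).symm

/-- The field is the composite of `Ψ_{1/f}`, the smooth section `(1/f) X` and the tangent map of
`Ψ_f`. -/
theorem isSmoothVField_pushRescaled (hf : ContMDiff I 𝓘(ℝ, ℝ) ∞ f) (hf0 : ∀ x, f x ≠ 0)
    {X : VField (cotModel I) (CotangentBundle I M)} (hX : IsSmoothVField (cotModel I) X) :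
    IsSmoothVField (cotModel I) (pushRescaled f X) := by
  have hc : ContMDiff (cotModel I) 𝓘(ℝ, ℝ) ∞
      (fun b : CotangentBundle I M => 1 / f b.proj) := fun b =>
    ContMDiffAt.comp (g := fun x : M => 1 / f x) b (contMDiff_one_div hf hf0 b.proj)
      contMDiffAt_cotangent_proj
  have h1 : ContMDiff (cotModel I) (cotModel I).tangent ∞
      (fun b => (⟨b, (1 / f b.proj) • X b⟩ : TangentBundle (cotModel I) (CotangentBundle I M))) :=
    hc.smul_section hX
  have h2 := ((contMDiff_fiberScale hf).contMDiff_tangentMap (m := ∞) le_rfl).comp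
    (h1.comp (contMDiff_fiberScale (contMDiff_one_div hf hf0)))
  refine h2.congr fun c => ?_
  exact tangentBundle_mk_eq (fiberScale_fiberScale_inv hf0 c).symm rfl

theorem canonicalForm_smul_left [I.Boundaryless] (b : CotangentBundle I M) (c : ℝ)
    (u v : TangentSpace (cotModel I) b) :
    canonicalForm I M b (c • u) v = c * canonicalForm I M b u v := by
  have hs := smoothOneFormAt_canonicalOneForm b
  have h : ∀ x y : E × (E →L[ℝ] ℝ), extD (cotModel I) (canonicalOneForm I M) b (c • x) y =
      c * extD (cotModel I) (canonicalOneForm I M) b x y := by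
    intro x y
    rw [extD_apply hs, extD_apply hs, map_smul, map_smul, mul_sub]
    rfl
  exact (congrArg Neg.neg (h u v)).trans (mul_neg _ _).symm

theorem dfWedgeTheta_smul_left (b : CotangentBundle I M) (c : ℝ)
    (u v : TangentSpace (cotModel I) b) :
    dfWedgeTheta I f b (c • u) v = c * dfWedgeTheta I f b u v := by
  simp only [dfWedgeTheta, map_smul, smul_eq_mul]
  ring

end FiberScaling

end NHReduction

end

/-! ### The equivalence -/

open NHReduction in
theorem mainTheorem11
    -- the configuration manifold `Q` and the symmetry group `G`
    {EQ : Type*} [NormedAddCommGroup EQ] [NormedSpace ℝ EQ] [FiniteDimensional ℝ EQ]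
    {Q : Type*} [TopologicalSpace Q] [ChartedSpace EQ Q] [IsManifold 𝓘(ℝ, EQ) ∞ Q]
    {EG : Type*} [NormedAddCommGroup EG] [NormedSpace ℝ EG] [FiniteDimensional ℝ EG]
    {G : Type*} [TopologicalSpace G] [ChartedSpace EG G] [Group G] [LieGroup 𝓘(ℝ, EG) ∞ G]
    [MulAction G Q] [ContMDiffSMul 𝓘(ℝ, EG) 𝓘(ℝ, EQ) ∞ G Q]
    -- the abelian quotient group `H = G / G_W` and the manifold `Qb = Q / G_W`
    {EH : Type*} [NormedAddCommGroup EH] [NormedSpace ℝ EH] [FiniteDimensional ℝ EH]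
    {H : Type*} [TopologicalSpace H] [ChartedSpace EH H] [CommGroup H] [LieGroup 𝓘(ℝ, EH) ∞ H]
    {EB : Type*} [NormedAddCommGroup EB] [NormedSpace ℝ EB] [FiniteDimensional ℝ EB]
    {Qb : Type*} [TopologicalSpace Qb] [ChartedSpace EB Qb] [IsManifold 𝓘(ℝ, EB) ∞ Qb]
    [MulAction H Qb] [ContMDiffSMul 𝓘(ℝ, EH) 𝓘(ℝ, EB) ∞ H Qb]
    -- the manifolds `S = Qb / H` and `N = (T*Qb) / H`
    {ES : Type*} [NormedAddCommGroup ES] [NormedSpace ℝ ES] [FiniteDimensional ℝ ES]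
    {S : Type*} [TopologicalSpace S] [ChartedSpace ES S] [IsManifold 𝓘(ℝ, ES) ∞ S]
    {EN : Type*} [NormedAddCommGroup EN] [NormedSpace ℝ EN] [FiniteDimensional ℝ EN]
    {N : Type*} [TopologicalSpace N] [ChartedSpace EN N] [IsManifold 𝓘(ℝ, EN) ∞ N]
    -- the nonholonomic system, its symmetries and the vertical complement
    (sys : NonholonomicSystem EQ Q) (hG : IsSymmetryGroup G sys)
    (W : (q : Q) → Submodule ℝ (TangentSpace 𝓘(ℝ, EQ) q))
    (𝔤W : Submodule ℝ (GroupLieAlgebra 𝓘(ℝ, EG) G)) (hW : IsVerticalComplement G sys W 𝔤W)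
    (AW : (q : Q) → TangentSpace 𝓘(ℝ, EQ) q →L[ℝ] GroupLieAlgebra 𝓘(ℝ, EG) G)
    (hAW : IsVerticalOneForm sys.D 𝔤W AW)
    -- compression by `G_W = ker ϱ`
    (ϱ : G →* H) (hϱ : IsLieQuotient (EH := EH) ϱ 𝔤W)
    (πW : Q → Qb)
    (hπW : IsOrbitProjection 𝓘(ℝ, EQ) 𝓘(ℝ, EB) (fun (g : ϱ.ker) (q : Q) => (g : G) • q) πW)
    (hact : ∀ (g : G) (q : Q), ϱ g • πW q = πW (g • q))
    (κb : Metric EB Qb) (hκb : IsCompressedMetric sys πW κb)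
    (h : CotangentBundle 𝓘(ℝ, EB) Qb → ℝ) (hh : IsCompressedHamiltonian sys πW κb h)
    (jk : TwoForm (cotModel 𝓘(ℝ, EB)) (CotangentBundle 𝓘(ℝ, EB) Qb))
    (hjk : IsCompressedJK sys AW πW κb jk)
    (Xnh : VField (cotModel 𝓘(ℝ, EB)) (CotangentBundle 𝓘(ℝ, EB) Qb))
    (hXnh : IsCompressedDynamics jk h Xnh)
    -- the gauge 2-form `B`, with `jk + B` basic for the projection `ρH` to `(T*Qb) / H`
    (B : TwoForm (cotModel 𝓘(ℝ, EB)) (CotangentBundle 𝓘(ℝ, EB) Qb))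
    (hB : ∀ a w, B a (Xnh a) w = 0)
    (ρH : CotangentBundle 𝓘(ℝ, EB) Qb → N)
    (hρH : IsOrbitProjection (cotModel 𝓘(ℝ, EB)) 𝓘(ℝ, EN)
      (fun (g : H) (a : CotangentBundle 𝓘(ℝ, EB) Qb) => cotangentLift g a) ρH)
    (𝔅 : TwoForm 𝓘(ℝ, EN) N) (h𝔅 : IsReductionOfSum jk B ρH 𝔅)
    -- the leaf at the momentum value `μ`, realized on `T*S`
    (π : Qb → S)
    (hπ : IsOrbitProjection 𝓘(ℝ, EB) 𝓘(ℝ, ES) (fun (g : H) (q : Qb) => g • q) π)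
    (A : (q : Qb) → TangentSpace 𝓘(ℝ, EB) q →L[ℝ] GroupLieAlgebra 𝓘(ℝ, EH) H)
    (hA : IsMechanicalConnection κb A)
    (μ : GroupLieAlgebra 𝓘(ℝ, EH) H →L[ℝ] ℝ)
    (β : TwoForm 𝓘(ℝ, ES) S) (hβ : IsMagneticForm A μ π β)
    (Υ : CotangentBundle 𝓘(ℝ, ES) S → N) (hΥ : IsShift A μ π ρH Υ)
    (Ωμ : TwoForm (cotModel 𝓘(ℝ, ES)) (CotangentBundle 𝓘(ℝ, ES) S))
    (hΩμ : IsReducedCanonicalForm (EN := EN) μ ρH Υ Ωμ)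
    (hμ : CotangentBundle 𝓘(ℝ, ES) S → ℝ) (hhμ : IsReducedHamiltonian μ ρH Υ h hμ)
    (Xred : VField (cotModel 𝓘(ℝ, ES)) (CotangentBundle 𝓘(ℝ, ES) S))
    (hXred : IsReducedDynamics Ωμ Υ 𝔅 hμ Xred)
    -- the candidate conformal factor
    (f : S → ℝ) (hf : ContMDiff 𝓘(ℝ, ES) 𝓘(ℝ, ℝ) ∞ f) (hf0 : ∀ x, f x ≠ 0) :
    (∃ XC : VField (cotModel 𝓘(ℝ, ES)) (CotangentBundle 𝓘(ℝ, ES) S),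
        IsSmoothVField (cotModel 𝓘(ℝ, ES)) XC ∧
        (∀ b, mfderiv (cotModel 𝓘(ℝ, ES)) (cotModel 𝓘(ℝ, ES)) (fiberScale 𝓘(ℝ, ES) f) b
            ((1 / f b.proj) • Xred b) = XC (fiberScale 𝓘(ℝ, ES) f b)) ∧
        ∀ b w, canonicalForm 𝓘(ℝ, ES) S b (XC b) w
          = mvfderiv (cotModel 𝓘(ℝ, ES))
              (hμ ∘ fiberScale 𝓘(ℝ, ES) (fun x => 1 / f x)) b w) ↔
      ∀ b w, dfWedgeTheta 𝓘(ℝ, ES) f b (Xred b) w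
        - f b.proj * (β b.proj (tproj 𝓘(ℝ, ES) S b (Xred b)) (tproj 𝓘(ℝ, ES) S b w)
            + pullbackForm Υ 𝔅 b (Xred b) w) = 0 := by
  have hΩ := reducedCanonicalForm_eq hA hπ hβ hρH.smooth hΥ hΩμ
  -- The equivalence holds for each pair `(b, w)`: Hamilton's equation for the pushed field at `Ψ_f
  -- b`, tested on `TΨ_f w`, against the second condition at `b`, tested on `w`.
  have key : ∀ (b : CotangentBundle 𝓘(ℝ, ES) S) (w : TangentSpace (cotModel 𝓘(ℝ, ES)) b),
      canonicalForm 𝓘(ℝ, ES) S (fiberScale 𝓘(ℝ, ES) f b)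
        (mfderiv (cotModel 𝓘(ℝ, ES)) (cotModel 𝓘(ℝ, ES)) (fiberScale 𝓘(ℝ, ES) f) b
          ((1 / f b.proj) • Xred b))
        (mfderiv (cotModel 𝓘(ℝ, ES)) (cotModel 𝓘(ℝ, ES)) (fiberScale 𝓘(ℝ, ES) f) b w) =
      mvfderiv (cotModel 𝓘(ℝ, ES)) (hμ ∘ fiberScale 𝓘(ℝ, ES) (fun x => 1 / f x))
        (fiberScale 𝓘(ℝ, ES) f b)
        (mfderiv (cotModel 𝓘(ℝ, ES)) (cotModel 𝓘(ℝ, ES)) (fiberScale 𝓘(ℝ, ES) f) b w) ↔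
      dfWedgeTheta 𝓘(ℝ, ES) f b (Xred b) w
        - f b.proj * (β b.proj (tproj 𝓘(ℝ, ES) S b (Xred b)) (tproj 𝓘(ℝ, ES) S b w)
            + pullbackForm Υ 𝔅 b (Xred b) w) = 0 := by
    intro b w
    rw [canonicalForm_fiberScale hf, canonicalForm_smul_left, dfWedgeTheta_smul_left,
      mvfderiv_comp_fiberScale_inv hhμ.smooth hf hf0, ← hXred.hamilton b w, hΩ b (Xred b) w]
    -- What remains is scalar: `f (x / f) - y / f = x - z - t` iff `y = f (z + t)`.
    have h0 := hf0 b.proj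
    generalize canonicalForm 𝓘(ℝ, ES) S b (Xred b) w = x
    generalize dfWedgeTheta 𝓘(ℝ, ES) f b (Xred b) w = y
    generalize β b.proj (tproj 𝓘(ℝ, ES) S b (Xred b)) (tproj 𝓘(ℝ, ES) S b w) = z
    generalize pullbackForm Υ 𝔅 b (Xred b) w = t
    field_simp
    constructor <;> intro h <;> linarith
  constructor
  · rintro ⟨XC, -, hpush, hham⟩ b w
    rw [← key, hpush]
    exact hham _ _
  · intro hcond
    refine ⟨pushRescaled f Xred, isSmoothVField_pushRescaled hf hf0 hXred.smooth,
      pushRescaled_fiberScale hf0 Xred, fun c w => ?_⟩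
    -- Every covector is some `Ψ_f b` and every tangent vector there some `TΨ_f w`, so `key` covers
    -- the whole equation.
    obtain ⟨b, rfl⟩ : ∃ b, fiberScale 𝓘(ℝ, ES) f b = c := ⟨_, fiberScale_fiberScale_inv hf0 c⟩
    obtain ⟨w, rfl⟩ := mfderiv_fiberScale_surjective hf hf0 b w
    rw [← pushRescaled_fiberScale hf0]
    exact (key b w).2 (hcond b w)
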